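/- All knots are tame knots in $S^3$ (closed curves that are the core $S^1\times 0$ of an open embedding $S^1\times\mathbb R^2\to S^3$), and $G(K)=\pi_1(S^3-K)$. An element of $G(K)$ is a \emph{meridian} if it is freely homotopic to a meridian curve (with any orientation) on the boundary of a tubular neighborhood of $K$; a homomorphism of knot groups is \emph{meridional} if it sends a meridian to a meridian. A group $G$ is \emph{residually solvable} if $\bigcap_{n<\infty}G^{(n)}=\{e\}$, where $G^{(0)}=G$ and $G^{(n+1)}=[G^{(n)},G^{(n)}]$. The \emph{Alexander polynomial} of a knot is the determinant of the Fox matrix over $\mathbb Z[t^{\pm1}]$ of a deficiency one presentation of its group whose generators all map to $t$ under an abelianization $G\to\mathbb Z=\langle t\rangle$, with one column deleted; it is well defined up to units $\pm t^n$ and $t\leftrightarrow t^{-1}$. Let $K$, $J$, $T$ be knots and let $\alpha\subset S^3$ be an unknotted circle disjoint from $K$. Let $E_\alpha$ be the exterior of a tubular neighborhood of $\alpha$ disjoint from $K$ and let $E_J$ be the exterior of $J$. Glue $E_\alpha$ and $E_J$ along a homeomorphism of their boundary tori which identifies a zero-linking longitude and a meridian of $\alpha$ with a meridian and a zero-linking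 longitude of $J$, respectively (the meridians may have either sign, which includes the case of positively oriented meridians), and choose a homeomorphism of the resulting space onto $S^3$. The image of $K$ is the satellite knot $K(\alpha,J)$. Let $E_{K\cup\alpha}$ be the exterior of $K\cup\alpha$ and $G(K\cup\alpha)=\pi_1(E_{K\cup\alpha})$; let $i_*\colon G(K\cup\alpha)\to G(K)$ and $j_*\colon G(K\cup\alpha)\to G(K(\alpha,J))$ be induced by the inclusions. Suppose that $G(T)$ is residually solvable and that $J$ has Alexander polynomial one. Then there is a meridional epimorphism $q\colon G(K(\alpha,J))\to G(K)$ with $q\circ j_*=i_*$, and for every such $q$ and every homomorphism $f\colon G(K(\alpha,J))\to G(T)$ there is a homomorphism $f'\colon G(K)\to G(T)$ with $f'\circ q=f$ and $f'\circ i_*=f\circ j_*$, such that 1. if $f$ is an epimorphism, then $f'$ is an epimorphism; 2. if $f$ is meridional, then $f'$ is meridional. -/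

import Mathlib

open scoped LaurentPolynomial

noncomputable section

namespace KnotTheory

/-- The `3`-sphere, as the unit sphere of Euclidean `4`-space. -/
abbrev S3 : Type := Metric.sphere (0 : EuclideanSpace ℝ (Fin 4)) 1

/-- An (open) tubular neighbourhood of a closed curve `k` in `S³`, with a trivialization:
an open embedding of `S¹ × ℝ²` whose core is `k`.  The closed tube is the image of
`S¹ × D²`, where `D²` is the closed unit disk. -/
structure IsTube (k : Circle → S3) (ν : Circle × ℂ → S3) : Prop where
  isOpenEmbedding : Topology.IsOpenEmbedding ν
  core : ∀ z, ν (z, 0) = k z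

/-- A (tame) knot in `S³`: a closed curve which admits a tubular neighbourhood.
(In particular the curve is a topological embedding of the circle.) -/
structure Knot where
  curve : Circle → S3
  tame : ∃ ν, IsTube curve ν

/-- The point set of a knot. -/
def Knot.carrier (K : Knot) : Set S3 := Set.range K.curve

/-- The complement `S³ - K`. -/
abbrev Knot.Complement (K : Knot) : Type := {x : S3 // x ∉ K.carrier}

/-- The knot group `G(K) = π₁(S³ - K)` (with base point `x`). -/
abbrev Knot.Group (K : Knot) (x : K.Complement) : Type := FundamentalGroup K.Complement x

/-- A knot is unknotted if some homeomorphism of `S³` carries it onto a standard great circle. -/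
def Knot.IsUnknotted (K : Knot) : Prop :=
  ∃ h : S3 ≃ₜ S3, h '' K.carrier = {x : S3 | x.1 2 = 0 ∧ x.1 3 = 0}

/-- The loop `t ↦ c (exp (2πit))`, `0 ≤ t ≤ 1`, traversing a closed curve `c`. -/
def circleLoop {X : Type*} [TopologicalSpace X] (c : C(Circle, X)) : Path (c 1) (c 1) where
  toFun t := c (Circle.exp (2 * Real.pi * (t : ℝ)))
  continuous_toFun := by fun_prop
  source' := by simp
  target' := by simp

theorem IsTube.notMem {K : Knot} {ν : Circle × ℂ → S3} (h : IsTube K.curve ν) (z w : Circle) :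
    ν (z, (w : ℂ)) ∉ K.carrier := by
  rintro ⟨z', hz'⟩
  rw [← h.core z'] at hz'
  have := congrArg Prod.snd (h.isOpenEmbedding.injective hz')
  exact Circle.coe_ne_zero w this.symm

/-- The meridian curve `w ↦ ν (1, w)` on the boundary of a closed tube about `K`. -/
def IsTube.meridian {K : Knot} {ν : Circle × ℂ → S3} (h : IsTube K.curve ν) :
    C(Circle, K.Complement) where
  toFun w := ⟨ν (1, (w : ℂ)), h.notMem 1 w⟩
  continuous_toFun :=
    (h.isOpenEmbedding.continuous.comp (by fun_prop)).subtype_mk _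

/-- The longitude curve `z ↦ ν (z, 1)` on the boundary of a closed tube about `K`. -/
def IsTube.longitude {K : Knot} {ν : Circle × ℂ → S3} (h : IsTube K.curve ν) :
    C(Circle, K.Complement) where
  toFun z := ⟨ν (z, ((1 : Circle) : ℂ)), h.notMem z 1⟩
  continuous_toFun :=
    (h.isOpenEmbedding.continuous.comp (by fun_prop)).subtype_mk _

/-- The longitude of the tube has linking number zero with `K`: it is null-homologous in
`S³ - K`, i.e. its class in the knot group lies in the commutator subgroup
(the kernel of `π₁ → H₁`). -/
def IsTube.ZeroLinking {K : Knot} {ν : Circle × ℂ → S3} (h : IsTube K.curve ν) : Prop :=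
  FundamentalGroup.fromPath (Path.Homotopic.Quotient.mk (circleLoop h.longitude)) ∈
    commutator (K.Group (h.longitude 1))

/-- `g ∈ G(K)` is a meridian: it is freely homotopic to a meridian curve `c` on the boundary of
a tubular neighbourhood of `K`, i.e. `g = [p · c · p⁻¹]` for a path `p` from the base point
to `c`.  Tubes of either orientation are allowed, so that meridians are unoriented. -/
def Knot.IsMeridian (K : Knot) {x : K.Complement} (g : K.Group x) : Prop :=
  ∃ (ν : Circle × ℂ → S3) (h : IsTube K.curve ν) (p : Path x (h.meridian 1)),
    g = FundamentalGroup.fromPath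
      (Path.Homotopic.Quotient.mk ((p.trans (circleLoop h.meridian)).trans p.symm))

/-- A homomorphism of knot groups is meridional if it sends a meridian to a meridian. -/
def IsMeridional {K L : Knot} {x : K.Complement} {y : L.Complement}
    (f : K.Group x →* L.Group y) : Prop :=
  ∃ m : K.Group x, K.IsMeridian m ∧ L.IsMeridian (f m)

/-- A group is residually solvable if `G^(ω) = ⋂ₙ G^(n)` is trivial. -/
def IsResiduallySolvable (G : Type*) [Group G] : Prop :=
  ⨅ n : ℕ, derivedSeries G n = ⊥

/-! ### Fox calculus and the Alexander polynomial -/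

section Fox

variable {ι : Type*} [DecidableEq ι]

/-- The Fox derivative `∂/∂xⱼ` of a word, from `∂(x w) = ∂x + x ∂w`, `∂xᵢ = δᵢⱼ`,
`∂xᵢ⁻¹ = -δᵢⱼ xᵢ⁻¹`. -/
def foxWord (j : ι) : List (ι × Bool) → MonoidAlgebra ℤ (FreeGroup ι)
  | [] => 0
  | (i, true) :: w =>
      (if i = j then 1 else 0) + MonoidAlgebra.of ℤ _ (FreeGroup.of i) * foxWord j w
  | (i, false) :: w =>
      MonoidAlgebra.of ℤ _ (FreeGroup.of i)⁻¹ * (foxWord j w - (if i = j then 1 else 0))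

/-- The Fox derivative `∂/∂xⱼ` on the free group. -/
def foxDeriv (j : ι) (w : FreeGroup ι) : MonoidAlgebra ℤ (FreeGroup ι) :=
  foxWord j w.toWord

theorem foxWord_append (j : ι) (u v : List (ι × Bool)) :
    foxWord j (u ++ v) = foxWord j u + MonoidAlgebra.of ℤ _ (FreeGroup.mk u) * foxWord j v := by
  induction u with
  | nil =>
    have h : FreeGroup.mk ([] : List (ι × Bool)) = 1 := rfl
    rw [h, map_one]
    simp [foxWord]
  | cons a u ih =>
    obtain ⟨i, b⟩ := a
    have h : FreeGroup.mk ((i, b) :: u) = FreeGroup.mk [(i, b)] * FreeGroup.mk u := by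
      simp
    cases b with
    | true =>
      have h' : FreeGroup.mk [(i, true)] = FreeGroup.of i := rfl
      rw [h, h', map_mul, List.cons_append]
      simp only [foxWord, ih]
      noncomm_ring
    | false =>
      have h' : FreeGroup.mk [(i, false)] = (FreeGroup.of i)⁻¹ := rfl
      rw [h, h', map_mul, List.cons_append]
      simp only [foxWord, ih]
      noncomm_ring

theorem foxWord_step (j : ι) {u v : List (ι × Bool)} (h : FreeGroup.Red.Step u v) :
    foxWord j u = foxWord j v := by
  obtain @⟨L₁, L₂, i, b⟩ := h
  rw [foxWord_append, foxWord_append]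
  congr 2
  cases b with
  | true =>
    simp only [foxWord, Bool.not_true]
    rw [← mul_assoc, ← map_mul, mul_inv_cancel, map_one]
    noncomm_ring
  | false =>
    simp only [foxWord, Bool.not_false]
    rw [mul_sub, mul_add, ← mul_assoc, ← map_mul, inv_mul_cancel, map_one]
    noncomm_ring

theorem foxDeriv_mk (j : ι) (w : List (ι × Bool)) :
    foxDeriv j (FreeGroup.mk w) = foxWord j w := by
  have h : FreeGroup.Red w (FreeGroup.mk w).toWord := by
    rw [FreeGroup.toWord_mk]; exact FreeGroup.reduce.red
  unfold foxDeriv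
  generalize (FreeGroup.mk w).toWord = v at h
  induction h with
  | refl => rfl
  | tail _ hs ih => rw [← foxWord_step j hs, ih]

theorem foxDeriv_of (i j : ι) : foxDeriv j (FreeGroup.of i) = if i = j then 1 else 0 := by
  simp [foxDeriv, foxWord]

/-- The product rule characterizing the Fox derivative. -/
theorem foxDeriv_mul (j : ι) (u v : FreeGroup ι) :
    foxDeriv j (u * v) = foxDeriv j u + MonoidAlgebra.of ℤ _ u * foxDeriv j v := by
  conv_lhs => rw [← FreeGroup.mk_toWord (x := u), ← FreeGroup.mk_toWord (x := v),
    FreeGroup.mul_mk, foxDeriv_mk, foxWord_append, FreeGroup.mk_toWord]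
  rfl

end Fox

/-- The homomorphism from the free group to the units of `ℤ[t, t⁻¹]` sending each generator
to `t`. -/
def freeToLaurent (ι : Type*) : FreeGroup ι →* ℤ[T;T⁻¹]ˣ :=
  FreeGroup.lift fun _ =>
    ⟨LaurentPolynomial.T 1, LaurentPolynomial.T (-1),
      by rw [← LaurentPolynomial.T_add]; simp, by rw [← LaurentPolynomial.T_add]; simp⟩

/-- The linear extension `ℤ[F] → ℤ[t, t⁻¹]` of the homomorphism sending each generator to `t`. -/
def groupRingToLaurent (ι : Type*) : MonoidAlgebra ℤ (FreeGroup ι) →ₐ[ℤ] ℤ[T;T⁻¹] :=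
  MonoidAlgebra.lift ℤ _ _ ((Units.coeHom _).comp (freeToLaurent ι))

/-- `Δ` is an Alexander polynomial of the knot group `G`: there is a deficiency one presentation
`⟨x₀, …, xₖ ∣ r₁, …, rₖ⟩` of `G`, such that an abelianization `G → ℤ = ⟨t⟩` maps each
generator to `t`, and such that, after deleting a column `j` of the `k × (k + 1)` Alexander matrix
`(∂rᵢ/∂xₗ)` over `ℤ[t, t⁻¹]`, the determinant is `Δ` up to multiplication by a unit `± tⁿ`.
For a knot group this does not depend on the presentation, up to units and `t ↔ t⁻¹`. -/
def HasAlexanderPolynomial (G : Type*) [Group G] (Δ : ℤ[T;T⁻¹]) : Prop :=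
  ∃ (k : ℕ) (r : Fin k → FreeGroup (Fin (k + 1))) (e : PresentedGroup (Set.range r) ≃* G)
    (a : G →* Multiplicative ℤ) (j : Fin (k + 1)),
    a.ker = commutator G ∧
    (∀ l, a (e (PresentedGroup.of l)) = Multiplicative.ofAdd 1) ∧
    Associated Δ (Matrix.det (Matrix.of fun (i l : Fin k) =>
      groupRingToLaurent (Fin (k + 1)) (foxDeriv (j.succAbove l) (r i))))

/-! ### The satellite construction -/

/-- The closed tube `ν(S¹ × D²)`. -/
def closedTube (ν : Circle × ℂ → S3) : Set S3 := ν '' {p | ‖p.2‖ ≤ 1}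

/-- The exterior: the complement of the interior `ν(S¹ × int D²)` of the closed tube. -/
def exterior (ν : Circle × ℂ → S3) : Set S3 := (ν '' {p | ‖p.2‖ < 1})ᶜ

/-- The relation on `E_α ⊔ E_J` which identifies the boundary tori by interchanging meridian and
longitude: `ν_α(z, w) ∼ ν_J(w, z)` for `z, w ∈ S¹`. -/
def GlueRel (να νJ : Circle × ℂ → S3) : exterior να ⊕ exterior νJ → exterior να ⊕ exterior νJ → Prop
  | .inl p, .inr q => ∃ z w : Circle, p.1 = να (z, (w : ℂ)) ∧ q.1 = νJ (w, (z : ℂ))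
  | _, _ => False

/-- The space `E_α ∪ E_J` obtained by gluing the two exteriors along their boundary tori,
with the quotient topology. -/
abbrev Glued (να νJ : Circle × ℂ → S3) : Type := Quot (GlueRel να νJ)

/-- The choices made in forming a satellite knot `K(α, J)`: zero-framed tubes about `α` and `J`,
the one about `α` being disjoint from `K`, and a homeomorphism onto `S³` of the space
`E_α ∪ E_J`, which is glued so that the zero-linking longitude and the meridian of `α` become the
meridian and the zero-linking longitude of `J`.  The orientations of the tubes (and so the signs
of the meridians) are left free: the choices with positively oriented meridians give `K(α, J)`,
the other ones the same construction with `J` reversed or mirrored. -/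
structure Satellite (K α J : Knot) where
  tubeα : Circle × ℂ → S3
  tubeJ : Circle × ℂ → S3
  isTubeα : IsTube α.curve tubeα
  isTubeJ : IsTube J.curve tubeJ
  zeroLinkingα : isTubeα.ZeroLinking
  zeroLinkingJ : isTubeJ.ZeroLinking
  disjoint : Disjoint K.carrier (closedTube tubeα)
  homeo : Glued tubeα tubeJ ≃ₜ S3

namespace Satellite

variable {K α J : Knot} (S : Satellite K α J)

/-- The inclusion of `E_α` into `E_α ∪ E_J ≅ S³`. -/
def incl (p : exterior S.tubeα) : S3 := S.homeo (Quot.mk _ (Sum.inl p))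

theorem continuous_incl : Continuous S.incl :=
  S.homeo.continuous.comp (continuous_quot_mk.comp continuous_inl)

theorem incl_injective : Function.Injective S.incl := by
  intro p q hpq
  have h := S.homeo.injective hpq
  let F : exterior S.tubeα ⊕ exterior S.tubeJ → Set (exterior S.tubeα) :=
    Sum.elim (fun p => {p}) (fun b => {p | GlueRel S.tubeα S.tubeJ (Sum.inl p) (Sum.inr b)})
  have hF : ∀ a b, GlueRel S.tubeα S.tubeJ a b → F a = F b := by
    rintro (a | a) (b | b) hab
    · exact hab.elim
    · ext c
      simp only [F, Sum.elim_inl, Sum.elim_inr, Set.mem_singleton_iff, Set.mem_ofPred_eq]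
      constructor
      · rintro rfl; exact hab
      · rintro ⟨z, w, h1, h2⟩
        obtain ⟨z', w', h1', h2'⟩ := hab
        have h3 := S.isTubeJ.isOpenEmbedding.injective (h2.symm.trans h2')
        have h4 : w = w' := congrArg Prod.fst h3
        have h5 : (z : ℂ) = z' := congrArg Prod.snd h3
        have h5' : z = z' := Subtype.ext h5
        apply Subtype.ext
        rw [h1, h1', h4, h5']
    · exact hab.elim
    · exact hab.elim
  have h' := congrArg (Quot.lift F hF) h
  simpa [F] using h'

theorem mem_exterior_of_notMem {ν : Circle × ℂ → S3} {x : S3} (h : x ∉ closedTube ν) :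
    x ∈ exterior ν := by
  rintro ⟨p, hp, rfl⟩
  exact h ⟨p, le_of_lt (show ‖p.2‖ < 1 from hp), rfl⟩

theorem isClosed_closedTube {k : Circle → S3} {ν : Circle × ℂ → S3} (h : IsTube k ν) :
    IsClosed (closedTube ν) := by
  have : {p : Circle × ℂ | ‖p.2‖ ≤ 1} = Set.univ ×ˢ Metric.closedBall (0 : ℂ) 1 := by
    ext p; simp
  unfold closedTube
  rw [this]
  exact ((isCompact_univ.prod (isCompact_closedBall _ _)).image
    h.isOpenEmbedding.continuous).isClosed

/-- The interior of `E_α` is embedded in `S³` as an open subset. -/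
theorem isOpenEmbedding_incl :
    Topology.IsOpenEmbedding fun x : {x : S3 // x ∉ closedTube S.tubeα} =>
      S.incl ⟨x.1, mem_exterior_of_notMem x.2⟩ := by
  apply Topology.IsOpenEmbedding.of_continuous_injective_isOpenMap
  · exact S.continuous_incl.comp (continuous_subtype_val.subtype_mk _)
  · intro x y h
    exact Subtype.ext (congrArg (fun p : exterior S.tubeα => p.1) (S.incl_injective h))
  · intro V hV
    have hU : IsOpen {x : S3 | x ∉ closedTube S.tubeα} :=
      (isClosed_closedTube S.isTubeα).isOpen_compl
    have hV' : IsOpen (Subtype.val '' V : Set S3) := hU.isOpenMap_subtype_val V hV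
    have key : ((fun x : {x : S3 // x ∉ closedTube S.tubeα} =>
        S.incl ⟨x.1, mem_exterior_of_notMem x.2⟩) '' V) =
        S.homeo '' {c | ∃ x ∈ V, Quot.mk _ (Sum.inl ⟨x.1, mem_exterior_of_notMem x.2⟩) = c} := by
      ext y
      constructor
      · rintro ⟨x, hx, rfl⟩; exact ⟨_, ⟨x, hx, rfl⟩, rfl⟩
      · rintro ⟨_, ⟨x, hx, rfl⟩, rfl⟩; exact ⟨x, hx, rfl⟩
    rw [key]
    apply S.homeo.isOpenMap
    rw [← isQuotientMap_quot_mk.isOpen_preimage, isOpen_sum_iff]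
    constructor
    · convert hV'.preimage (continuous_subtype_val (p := fun x => x ∈ exterior S.tubeα)) using 1
      ext p
      constructor
      · rintro ⟨x, hx, h⟩
        have := S.incl_injective (congrArg S.homeo h)
        exact ⟨x, hx, congrArg (fun p : exterior S.tubeα => p.1) this⟩
      · rintro ⟨x, hx, h⟩
        exact ⟨x, hx, congrArg (fun p => Quot.mk _ (Sum.inl p)) (Subtype.ext h)⟩
    · convert isOpen_empty using 1
      ext b
      simp only [Set.mem_preimage, Set.mem_ofPred_eq, Set.mem_empty_iff_false, iff_false]
      rintro ⟨x, -, h⟩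
      let F : exterior S.tubeα ⊕ exterior S.tubeJ → Prop :=
        Sum.elim (fun p => p.1 ∈ closedTube S.tubeα) (fun _ => True)
      have hF : ∀ a b, GlueRel S.tubeα S.tubeJ a b → F a = F b := by
        rintro (a | a) (b | b) hab
        · exact hab.elim
        · obtain ⟨z, w, h1, -⟩ := hab
          exact eq_true ⟨(z, (w : ℂ)), (Circle.norm_coe w).le, h1.symm⟩
        · exact hab.elim
        · exact hab.elim
      have h' := congrArg (Quot.lift F hF) h
      exact x.2 (of_eq_true (h'.trans rfl))

theorem notMem_closedTube (z : Circle) : K.curve z ∉ closedTube S.tubeα :=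
  Set.disjoint_left.mp S.disjoint ⟨z, rfl⟩

/-- The satellite knot `K(α, J)`: the image of `K ⊆ E_α` in `E_α ∪ E_J ≅ S³`. -/
def knot : Knot where
  curve z := S.incl ⟨K.curve z, mem_exterior_of_notMem (S.notMem_closedTube z)⟩
  tame := by
    obtain ⟨ν, hν⟩ := K.tame
    have hU : IsOpen (ν ⁻¹' (closedTube S.tubeα)ᶜ) :=
      (isClosed_closedTube S.isTubeα).isOpen_compl.preimage hν.isOpenEmbedding.continuous
    obtain ⟨u, v, -, hv, hu', hv', huv⟩ := generalized_tube_lemma (s := (Set.univ : Set Circle))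
      isCompact_univ (isCompact_singleton (x := (0 : ℂ))) hU (by
        rintro ⟨z, w⟩ ⟨-, hw⟩
        obtain rfl : w = 0 := hw
        rw [Set.mem_preimage, hν.core]
        exact S.notMem_closedTube z)
    obtain ⟨ε, hε, hball⟩ := Metric.isOpen_iff.mp hv 0 (hv' rfl)
    let b := OpenPartialHomeomorph.univBall (E := ℂ) (0 : ℂ) ε
    have hb : Topology.IsOpenEmbedding b :=
      b.isOpenEmbedding (OpenPartialHomeomorph.univBall_source _ _)
    have hmem : ∀ w, b w ∈ v := fun w => hball <| by
      have := b.map_source (x := w) (by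
        rw [OpenPartialHomeomorph.univBall_source]; trivial)
      rwa [OpenPartialHomeomorph.univBall_target _ hε] at this
    have h1 : Topology.IsOpenEmbedding fun p : Circle × ℂ => ν (p.1, b p.2) :=
      hν.isOpenEmbedding.comp (Topology.IsOpenEmbedding.id.prodMap hb)
    have h2 : ∀ p : Circle × ℂ, ν (p.1, b p.2) ∉ closedTube S.tubeα := fun p =>
      huv ⟨hu' trivial, hmem p.2⟩
    have h3 : Topology.IsOpenEmbedding fun p : Circle × ℂ =>
        (⟨ν (p.1, b p.2), h2 p⟩ : {x : S3 // x ∉ closedTube S.tubeα}) :=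
      Topology.IsOpenEmbedding.of_comp _
        (isClosed_closedTube S.isTubeα).isOpen_compl.isOpenEmbedding_subtypeVal h1
    refine ⟨_, S.isOpenEmbedding_incl.comp h3, fun z => ?_⟩
    have h0 : b 0 = 0 := OpenPartialHomeomorph.univBall_apply_zero _ _
    simp only [Function.comp_apply]
    congr 2
    rw [h0, hν.core]

/-- The exterior `E_{K ∪ α}`, realized as `E_α - K` (removing `K` itself instead of an open tube
around `K` does not change the homotopy type). -/
abbrev LinkExterior : Type := {x : S3 // x ∈ exterior S.tubeα ∧ x ∉ K.carrier}

/-- The inclusion of `E_{K ∪ α}` into `S³ - K`. -/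
def toComplement : C(S.LinkExterior, K.Complement) where
  toFun x := ⟨x.1, x.2.2⟩
  continuous_toFun := continuous_subtype_val.subtype_mk _

theorem incl_notMem (x : S.LinkExterior) : S.incl ⟨x.1, x.2.1⟩ ∉ S.knot.carrier := by
  rintro ⟨z, hz⟩
  exact x.2.2 ⟨z, congrArg (fun p : exterior S.tubeα => p.1) (S.incl_injective hz)⟩

/-- The inclusion of `E_{K ∪ α}` into `S³ - K(α, J)`. -/
def toSatellite : C(S.LinkExterior, S.knot.Complement) where
  toFun x := ⟨S.incl ⟨x.1, x.2.1⟩, S.incl_notMem x⟩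
  continuous_toFun :=
    (S.continuous_incl.comp (continuous_subtype_val.subtype_mk _)).subtype_mk _

/-- The link group `G(K ∪ α)`. -/
abbrev LinkGroup (x : S.LinkExterior) : Type := FundamentalGroup S.LinkExterior x

/-- The inclusion-induced homomorphism `G(K ∪ α) → G(K)`. -/
def iStar (x : S.LinkExterior) : S.LinkGroup x →* K.Group (S.toComplement x) :=
  FundamentalGroup.map S.toComplement x

/-- The inclusion-induced homomorphism `G(K ∪ α) → G(K(α, J))`. -/
def jStar (x : S.LinkExterior) : S.LinkGroup x →* S.knot.Group (S.toSatellite x) :=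
  FundamentalGroup.map S.toSatellite x

/-- `q : G(K(α, J)) → G(K)` is a satellite quotient map: a meridional epimorphism which is
compatible with the inclusion-induced homomorphisms of `G(K ∪ α)`. -/
structure IsQuotientMap (x : S.LinkExterior)
    (q : S.knot.Group (S.toSatellite x) →* K.Group (S.toComplement x)) : Prop where
  surjective : Function.Surjective q
  meridional : IsMeridional q
  comp_jStar : q.comp (S.jStar x) = S.iStar x

end Satellite

end KnotTheory

end

open KnotTheory

open Topology unitInterval KnotTheory

/-! ### Group-valued functors on the fundamental groupoid -/

/-! The complement of $K(\alpha,J)$ is $E_{K\cup\alpha}\cup E_J$, glued along a torus on which the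
meridian of $\alpha$ is the longitude of $J$ and the longitude of $\alpha$ is the meridian of $J$.
The complement of $K$ is $E_{K\cup\alpha}$ with a solid torus glued in, which kills the same curve,
the meridian of $\alpha$. Thus $G(K)$ should arise from $G(K(\alpha,J))$ by replacing $\pi_1(E_J)$
with its abelianization $\mathbb Z$, the group of the solid torus. This is possible for every $J$
because the longitude of $J$ is null-homologous (`Satellite.exists_isQuotientMap`).

If $J$ has Alexander polynomial one, Fox calculus shows that the commutator subgroup of $G(J)$ is
perfect (`commutator_perfect_of_hasAlexanderPolynomial`). The image of a perfect group lies in every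
term of the derived series, so it is trivial in a residually solvable group. Hence $f$ restricted to
$E_J$ kills the longitude of $J$ and is determined by the meridian of $J$. Killing that longitude
means killing the meridian of $\alpha$, so $f\circ j_*$ extends over the solid torus to $f'$ on
$G(K)$. The maps $f'\circ q$ and $f$ agree on $G(K\cup\alpha)$, and then on $E_J$ because the
meridian of $J$ lies on the common torus (`Satellite.exists_factorization`).

A meridian of the satellite shrinks radially into $E_{K\cup\alpha}$, where $q$ is the inclusion into
the complement of $K$. So $q$ carries meridians to meridians (`Satellite.isMeridian_map`), and both
properties of $f'$ follow from $f=f'\circ q$.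

The topological input is van Kampen's theorem. It is phrased for functors from the fundamental
groupoid to a fixed group, so that no base points have to be carried around: homomorphisms from a
fundamental group extend to such cocycles, and those with the same values on loops at one point
differ by a gauge transformation. The existence and uniqueness halves for closed pieces with a
collar are `CollaredPushout.exists_glue_of_loops` and `CollaredPushout.eq_on_loops`. -/

/-- A functor from the fundamental groupoid of `X` to a group `H`, given by its values on paths. -/
structure PathCocycle (X H : Type*) [TopologicalSpace X] [Group H] where
  toFun : ∀ {a b : X}, Path a b → H
  -- The order is reversed to match `FundamentalGroup`, where a product traverses its right factor
  -- first.
  map_trans' : ∀ {a b c : X} (p : Path a b) (q : Path b c),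
    toFun (p.trans q) = toFun q * toFun p
  map_homotopic' : ∀ {a b : X} {p q : Path a b}, p.Homotopic q → toFun p = toFun q

namespace PathCocycle

variable {X Y Z H H' : Type*} [TopologicalSpace X] [TopologicalSpace Y] [TopologicalSpace Z]
  [Group H] [Group H']

instance : CoeFun (PathCocycle X H) (fun _ => ∀ {a b : X}, Path a b → H) := ⟨PathCocycle.toFun⟩

theorem map_trans (c : PathCocycle X H) {x y z : X} (p : Path x y) (q : Path y z) :
    c (p.trans q) = c q * c p := c.map_trans' p q

theorem map_homotopic (c : PathCocycle X H) {x y : X} {p q : Path x y} (h : p.Homotopic q) :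
    c p = c q := c.map_homotopic' h

theorem map_refl (c : PathCocycle X H) (x : X) : c (Path.refl x) = 1 := by
  have h := c.map_trans (Path.refl x) (Path.refl x)
  rw [Path.refl_trans_refl] at h
  exact mul_eq_left.mp h.symm

theorem map_symm (c : PathCocycle X H) {x y : X} (p : Path x y) : c p.symm = (c p)⁻¹ := by
  have h : c (p.trans p.symm) = c (Path.refl x) :=
    c.map_homotopic ⟨(Path.Homotopy.reflTransSymm p).symm⟩
  rw [c.map_trans, c.map_refl] at h
  exact eq_inv_of_mul_eq_one_left h

/-- The value of a dependent function on paths depends only on the underlying function. -/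
theorem _root_.Path.dependent_congr {A : Type*} (F : ∀ {a b : X}, Path a b → A) {x y x' y' : X}
    {p : Path x y} {q : Path x' y'} (h : ∀ t, p t = q t) : F p = F q := by
  obtain rfl : x = x' := by simpa using h 0
  obtain rfl : y = y' := by simpa using h 1
  congr 1
  ext t
  exact h t

theorem congr_path (c : PathCocycle X H) {x y x' y' : X}
    {p : Path x y} {q : Path x' y'} (h : ∀ t, p t = q t) : c p = c q :=
  Path.dependent_congr c.toFun h

theorem map_const (c : PathCocycle X H) {x y : X} (p : Path x y) (h : ∀ t, p t = x) : c p = 1 := by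
  rw [← c.map_refl x]
  exact c.congr_path h

@[ext]
theorem ext {c c' : PathCocycle X H} (h : ∀ {a b : X} (p : Path a b), c p = c' p) : c = c' := by
  cases c; cases c'
  simp only [PathCocycle.mk.injEq]
  funext a b p
  exact h p

/-- Pullback of a cocycle along a continuous map. -/
def comap (c : PathCocycle X H) (f : C(Y, X)) : PathCocycle Y H where
  toFun p := c (p.map f.continuous)
  map_trans' p q := by rw [Path.map_trans, c.map_trans]
  map_homotopic' h := c.map_homotopic (h.map f)

/-- Change of a cocycle by a function on the points (a natural isomorphism of functors). -/
def gauge (c : PathCocycle X H) (g : X → H) : PathCocycle X H where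
  toFun {a b} p := g b * c p * (g a)⁻¹
  map_trans' p q := by rw [c.map_trans]; group
  map_homotopic' h := by rw [c.map_homotopic h]

theorem gauge_apply (c : PathCocycle X H) (g : X → H) {x y : X} (p : Path x y) :
    c.gauge g p = g y * c p * (g x)⁻¹ := rfl

/-- The trivial cocycle. -/
def trivial (X H : Type*) [TopologicalSpace X] [Group H] : PathCocycle X H where
  toFun _ := 1
  map_trans' _ _ := by simp
  map_homotopic' _ := rfl

theorem trivial_apply {x y : X} (p : Path x y) : trivial X H p = 1 := rfl

/-- Cocycles on a path connected space which agree on the loops at one point differ by a gauge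
transformation. -/
theorem exists_gauge [PathConnectedSpace X] (c c' : PathCocycle X H) (o : X)
    (h : ∀ p : Path o o, c p = c' p) : ∃ g : X → H, g o = 1 ∧ c' = c.gauge g := by
  let β : ∀ x, Path o x := fun x => PathConnectedSpace.somePath o x
  -- With `g o = 1`, the gauge equation for the path `β x` forces this value.
  refine ⟨fun x => c' (β x) * (c (β x))⁻¹, by simp [h], ?_⟩
  ext x y p
  have h1 := h (((β x).trans p).trans (β y).symm)
  simp only [map_trans, map_symm] at h1
  rw [gauge_apply]
  have h2 : c' p = c' (β y) * ((c' (β y))⁻¹ * (c' p * c' (β x))) * (c' (β x))⁻¹ := by group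
  rw [h2, ← h1]
  group

/-- A homomorphism out of the fundamental group extends to a cocycle. -/
theorem exists_extension [PathConnectedSpace X] (x : X) (φ : FundamentalGroup X x →* H) :
    ∃ c : PathCocycle X H, ∀ p : Path x x,
      c p = φ (FundamentalGroup.fromPath (Path.Homotopic.Quotient.mk p)) := by
  let β : ∀ y, Path.Homotopic.Quotient x y := fun y =>
    Path.Homotopic.Quotient.mk (PathConnectedSpace.somePath x y)
  let d : ∀ {a b : X}, Path.Homotopic.Quotient a b → H := fun {a b} p =>
    φ (FundamentalGroup.fromPath (((β a).trans p).trans (β b).symm))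
  have hd : ∀ {a b e : X} (p : Path.Homotopic.Quotient a b) (q : Path.Homotopic.Quotient b e),
      d (p.trans q) = d q * d p := by
    intro a b e p q
    simp only [d]
    rw [← map_mul, FundamentalGroup.mul_def]
    congr 1
    change (((β a).trans (p.trans q)).trans (β e).symm) =
      ((((β a).trans p).trans (β b).symm).trans (((β b).trans q).trans (β e).symm))
    have : (((β a).trans p).trans (β b).symm).trans (((β b).trans q).trans (β e).symm) =
      ((β a).trans (p.trans (((β b).symm.trans (β b)).trans (q.trans (β e).symm)))) := by
      simp only [Path.Homotopic.Quotient.trans_assoc]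
    rw [this, Path.Homotopic.Quotient.symm_trans, Path.Homotopic.Quotient.refl_trans]
    simp only [Path.Homotopic.Quotient.trans_assoc]
  let c : PathCocycle X H :=
    { toFun := fun p => d (Path.Homotopic.Quotient.mk p)
      map_trans' := fun p q => by rw [Path.Homotopic.Quotient.mk_trans, hd]
      map_homotopic' := fun h => by rw [Path.Homotopic.Quotient.eq.mpr h] }
  -- The chosen path `β x` is a loop at `x` that need not be constant, so `c` is `φ` only up to
  -- conjugation by its class; a constant gauge undoes this.
  have hc : ∀ p : Path x x, c.gauge (fun _ =>
      φ (FundamentalGroup.fromPath (β x))) p =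
      φ (FundamentalGroup.fromPath (Path.Homotopic.Quotient.mk p)) := by
    intro p
    rw [gauge_apply]
    change φ _ * φ _ * (φ _)⁻¹ = φ _
    rw [← map_mul, ← map_inv, ← map_mul, FundamentalGroup.mul_def, FundamentalGroup.mul_def,
      FundamentalGroup.inv_def]
    congr 1
    change (β x).symm.trans ((((β x).trans _).trans (β x).symm).trans (β x)) = _
    simp only [Path.Homotopic.Quotient.trans_assoc, Path.Homotopic.Quotient.symm_trans,
      Path.Homotopic.Quotient.trans_refl]
    rw [← Path.Homotopic.Quotient.trans_assoc, Path.Homotopic.Quotient.symm_trans,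
      Path.Homotopic.Quotient.refl_trans]
  exact ⟨_, hc⟩

/-- The homomorphism on the fundamental group given by a cocycle. -/
def toHom (c : PathCocycle X H) (x : X) : FundamentalGroup X x →* H where
  toFun g := Quotient.lift (fun p : Path x x => c p) (fun _ _ h => c.map_homotopic h)
    (FundamentalGroup.toPath g)
  map_one' := c.map_refl x
  map_mul' g g' := by
    induction g using Path.Homotopic.Quotient.ind with | _ p
    induction g' using Path.Homotopic.Quotient.ind with | _ q
    exact c.map_trans q p

/-- Naturality of a cocycle with respect to a homotopy, in the form of a cylinder `X × Y`. -/
theorem map_prod (c : PathCocycle (X × Y) H) {x x' : X} {y y' : Y} (p : Path x x')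
    (q : Path y y') : c (p.prod q) = c ((Path.refl x').prod q) * c (p.prod (Path.refl y)) := by
  rw [← c.map_trans, Path.trans_prod_eq_prod_trans]
  exact c.map_homotopic ⟨Path.Homotopic.prodHomotopy (Path.Homotopy.transRefl p).symm
    (Path.Homotopy.reflTrans q).symm⟩

theorem map_prod' (c : PathCocycle (X × Y) H) {x x' : X} {y y' : Y} (p : Path x x')
    (q : Path y y') : c (p.prod q) = c (p.prod (Path.refl y')) * c ((Path.refl x).prod q) := by
  rw [← c.map_trans, Path.trans_prod_eq_prod_trans]
  exact c.map_homotopic ⟨Path.Homotopic.prodHomotopy (Path.Homotopy.reflTrans p).symm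
    (Path.Homotopy.transRefl q).symm⟩

end PathCocycle

/-! ### Van Kampen's theorem for open covers -/

/-- A path with values in a subset, as a path in the subset. -/
def Path.restrictTo {X : Type*} [TopologicalSpace X] {x y : X} (p : Path x y) {W : Set X}
    (h : ∀ t, p t ∈ W) :
    Path (⟨x, by simpa using h 0⟩ : W) ⟨y, by simpa using h 1⟩ where
  toFun t := ⟨p t, h t⟩
  continuous_toFun := p.continuous.subtype_mk _
  source' := by simp
  target' := by simp

namespace PathCocycle

variable {X Y Z H : Type*} [TopologicalSpace X] [TopologicalSpace Y] [TopologicalSpace Z]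
  [Group H] {ι : Type*}

/-- The function `F` on paths is a cocycle on each of the sets `W i`. -/
def IsLocal (W : ι → Set X) (F : ∀ {a b : X}, Path a b → H) : Prop :=
  ∀ i, ∃ c : PathCocycle (W i) H, ∀ {a b : X} (p : Path a b) (h : ∀ t, p t ∈ W i),
    F p = c (p.restrictTo h)

section Local

variable {W : ι → Set X} {F : ∀ {a b : X}, Path a b → H}

theorem IsLocal.exists_apply (hF : IsLocal W F) (i : ι) : ∃ c : PathCocycle (W i) H,
    ∀ {a b : X} (p : Path a b) (h : ∀ t, p t ∈ W i), F p = c (p.restrictTo h) := hF i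

theorem IsLocal.map_refl (hF : IsLocal W F) (hc : ∀ x, ∃ i, x ∈ W i) (x : X) :
    F (Path.refl x) = 1 := by
  obtain ⟨i, hi⟩ := hc x
  obtain ⟨c, hc⟩ := hF.exists_apply i
  rw [hc (Path.refl x) (fun _ => hi)]
  exact c.map_const _ fun t => rfl

/-- Pulling back along a map into a single `W i` turns `F` into a genuine cocycle, so local
identities for `F` can be checked on the simpler source, an interval or a square. -/
theorem IsLocal.exists_comap (hF : IsLocal W F) (f : C(Y, X)) (i : ι) (hf : ∀ y, f y ∈ W i) :
    ∃ d : PathCocycle Y H, ∀ {x y : Y} (p : Path x y), F (p.map f.continuous) = d p := by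
  obtain ⟨c, hc⟩ := hF.exists_apply i
  refine ⟨c.comap ⟨fun y => ⟨f y, hf y⟩, f.continuous.subtype_mk _⟩, fun p => ?_⟩
  rw [hc (p.map f.continuous) (fun t => hf _)]
  exact c.congr_path fun t => rfl

/-- The tautological path in the unit interval. -/
def unitPath : Path (0 : I) 1 where
  toFun := id
  source' := rfl
  target' := rfl

theorem map_subpath_trans (c : PathCocycle X H) {x y : X} (p : Path x y) (s t u : I) :
    c (p.subpath s u) = c (p.subpath t u) * c (p.subpath s t) := by
  rw [← c.map_trans]
  exact c.map_homotopic ⟨(Path.Homotopy.subpathTransSubpath p s t u).symm⟩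

theorem IsLocal.subpath (hF : IsLocal W F) {x y : X} (p : Path x y) {s t u : I} (hst : s ≤ t)
    (htu : t ≤ u) {i : ι} (h : ∀ v ∈ Set.Icc s u, p v ∈ W i) :
    F (p.subpath s u) = F (p.subpath t u) * F (p.subpath s t) := by
  have hsu := hst.trans htu
  -- The restriction of `p` to `[s, u]`, extended by constants, so that all of `I` is mapped into `W
  -- i`.
  let f : C(I, X) := ⟨fun v => p (Set.projIcc s u hsu v),
    p.continuous.comp (continuous_subtype_val.comp continuous_projIcc)⟩
  obtain ⟨d, hd⟩ := hF.exists_comap f i (fun v => h _ (Set.projIcc s u hsu v).2)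
  have key : ∀ v w, s ≤ v → v ≤ w → w ≤ u → F (p.subpath v w) = d (unitPath.subpath v w) := by
    intro v w hsv hvw hwu
    rw [← hd]
    refine Path.dependent_congr F fun r => ?_
    change p _ = p _
    congr 1
    change Set.Icc.convexComb v w r = (Set.projIcc s u hsu (Set.Icc.convexComb v w r) : I)
    rw [Set.projIcc_of_mem hsu ⟨hsv.trans (Set.Icc.le_convexComb hvw r),
      (Set.Icc.convexComb_le hvw r).trans hwu⟩]
  rw [key s u le_rfl hsu le_rfl, key t u hst htu le_rfl, key s t le_rfl hst htu,
    map_subpath_trans]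

/-- A primitive of `F` along a path. -/
def IsPrimitive (W : ι → Set X) (F : ∀ {a b : X}, Path a b → H) {x y : X} (p : Path x y)
    (P : I → H) : Prop :=
  ∀ s t : I, s ≤ t → (∃ i, ∀ v ∈ Set.Icc s t, p v ∈ W i) → P t = F (p.subpath s t) * P s

theorem exists_partition (hW : ∀ i, IsOpen (W i)) (hc : ∀ x, ∃ i, x ∈ W i) {x y : X}
    (p : Path x y) : ∃ t : ℕ → I, t 0 = 0 ∧ Monotone t ∧ (∃ n, t n = 1) ∧
      ∀ n, ∃ i, ∀ v ∈ Set.Icc (t n) (t (n + 1)), p v ∈ W i := by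
  obtain ⟨t, h0, hm, ⟨n, hn⟩, h⟩ := exists_monotone_Icc_subset_open_cover_unitInterval
    (c := fun i => p ⁻¹' (W i)) (fun i => (hW i).preimage p.continuous)
    (fun v _ => Set.mem_iUnion.mpr (hc (p v)))
  exact ⟨t, h0, hm, ⟨n, hn n le_rfl⟩, h⟩

/-- Analytic continuation of the value along the path: each interval of a fine enough subdivision
lies in one set of the cover, and there `F` transports the value reached so far. -/
theorem IsLocal.exists_primitive (hF : IsLocal W F) (hW : ∀ i, IsOpen (W i))
    (hc : ∀ x, ∃ i, x ∈ W i) {x y : X} (p : Path x y) :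
    ∃ P : I → H, P 0 = 1 ∧ IsPrimitive W F p P := by
  obtain ⟨t, h0, hm, ⟨n, hn⟩, h⟩ := exists_partition hW hc p
  suffices ∀ n, ∃ P : I → H, P 0 = 1 ∧ ∀ s u : I, s ≤ u → u ≤ t n →
      (∃ i, ∀ v ∈ Set.Icc s u, p v ∈ W i) → P u = F (p.subpath s u) * P s by
    obtain ⟨P, hP0, hP⟩ := this n
    exact ⟨P, hP0, fun s u hsu => hP s u hsu (by rw [hn]; exact u.2.2)⟩
  intro n
  induction n with
  | zero =>
    refine ⟨fun _ => 1, rfl, fun s u hsu hu ⟨i, hi⟩ => ?_⟩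
    rw [h0] at hu
    obtain rfl : u = 0 := le_antisymm hu u.2.1
    obtain rfl : s = 0 := le_antisymm hsu s.2.1
    rw [Path.subpath_self, hF.map_refl hc, one_mul]
  | succ n ih =>
    obtain ⟨P, hP0, hP⟩ := ih
    obtain ⟨i, hi⟩ := h n
    refine ⟨fun u => if u ≤ t n then P u else F (p.subpath (t n) u) * P (t n), ?_, ?_⟩
    · simp [hP0]
    · rintro s u hsu hu ⟨j, hj⟩
      beta_reduce
      by_cases h1 : u ≤ t n
      · rw [if_pos h1, if_pos (hsu.trans h1)]
        exact hP s u hsu h1 ⟨j, hj⟩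
      · rw [if_neg h1]
        push Not at h1
        -- If `[s, u]` straddles `t n`, it is split there, inside the set `W j` containing its
        -- image; otherwise it lies in the new interval, inside `W i`.
        by_cases h2 : s ≤ t n
        · rw [if_pos h2, hP s (t n) h2 le_rfl ⟨j, fun v hv => hj v ⟨hv.1, hv.2.trans h1.le⟩⟩,
            ← mul_assoc, ← hF.subpath p h2 h1.le hj]
        · rw [if_neg h2, ← mul_assoc]
          push Not at h2
          rw [← hF.subpath p h2.le hsu (fun v hv => hi v ⟨hv.1, hv.2.trans hu⟩)]

theorem IsPrimitive.unique {x y : X} {p : Path x y} {P Q : I → H} (hP : IsPrimitive W F p P)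
    (hQ : IsPrimitive W F p Q) (hW : ∀ i, IsOpen (W i)) (hc : ∀ x, ∃ i, x ∈ W i)
    (h : P 0 = Q 0) : P 1 = Q 1 := by
  obtain ⟨t, h0, hm, ⟨n, hn⟩, hi⟩ := exists_partition hW hc p
  suffices ∀ n, P (t n) = Q (t n) by simpa [hn] using this n
  intro n
  induction n with
  | zero => rw [h0, h]
  | succ n ih =>
    rw [hP _ _ (hm n.le_succ) (hi n), hQ _ _ (hm n.le_succ) (hi n), ih]

theorem IsPrimitive.mul_right {x y : X} {p : Path x y} {P : I → H} (hP : IsPrimitive W F p P)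
    (h : H) : IsPrimitive W F p (fun t => P t * h) := fun s t hst hi => by
  beta_reduce
  rw [hP s t hst hi, mul_assoc]

/-- Used for the two halves of a concatenation. The reparametrization is required to be affine so
that it carries subpaths to subpaths on the nose. -/
theorem IsPrimitive.reparam {x y x' y' : X} {p : Path x y} {q : Path x' y'} {P : I → H}
    (hP : IsPrimitive W F p P) (φ : I → I) (hφ : Monotone φ)
    (hc : ∀ s t r, φ (Set.Icc.convexComb s t r) = Set.Icc.convexComb (φ s) (φ t) r)
    (h : ∀ t, q t = p (φ t)) : IsPrimitive W F q (fun t => P (φ t)) := by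
  rintro s t hst ⟨i, hi⟩
  have h1 : ∃ i, ∀ v ∈ Set.Icc (φ s) (φ t), p v ∈ W i := by
    refine ⟨i, fun v hv => ?_⟩
    have : v ∈ Set.range (Set.Icc.convexComb (φ s) (φ t)) := by
      rw [Path.range_subpathAux, Set.uIcc_of_le (hφ hst)]; exact hv
    obtain ⟨r, rfl⟩ := this
    rw [← hc, ← h]
    exact hi _ ⟨Set.Icc.le_convexComb hst r, Set.Icc.convexComb_le hst r⟩
  change P _ = _ * P _
  rw [hP _ _ (hφ hst) h1]
  congr 1
  refine Path.dependent_congr F fun r => ?_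
  change p _ = q _
  rw [h, hc]

/-- Both ways round the square are values of one cocycle on the diagonal of `I × I`, by `map_prod`
and `map_prod'`. -/
theorem IsLocal.square (hF : IsLocal W F) (g : C(I × I, X)) {i : ι} (hg : ∀ v, g v ∈ W i) :
    F (((Path.refl (1 : I)).prod unitPath).map g.continuous) *
      F ((unitPath.prod (Path.refl (0 : I))).map g.continuous) =
    F ((unitPath.prod (Path.refl (1 : I))).map g.continuous) *
      F (((Path.refl (0 : I)).prod unitPath).map g.continuous) := by
  obtain ⟨d, hd⟩ := hF.exists_comap g i hg
  rw [hd, hd, hd, hd, ← map_prod, ← map_prod']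

variable (W F) in
/-- Primitives along homotopic paths have the same value at the end. -/
theorem IsLocal.homotopy_eq (hF : IsLocal W F) (hW : ∀ i, IsOpen (W i))
    (hc : ∀ x, ∃ i, x ∈ W i) {x y : X} {p q : Path x y} (G : Path.Homotopy p q) {P Q : I → H}
    (hP : IsPrimitive W F p P) (hQ : IsPrimitive W F q Q) (hP0 : P 0 = 1) (hQ0 : Q 0 = 1) :
    P 1 = Q 1 := by
  obtain ⟨t, h0, hm, ⟨n, hn⟩, h⟩ := exists_monotone_Icc_subset_open_cover_unitInterval_prod_self
    (c := fun i => G ⁻¹' (W i)) (fun i => (hW i).preimage G.continuous)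
    (fun v _ => Set.mem_iUnion.mpr (hc (G v)))
  replace hn := hn n le_rfl
  choose R hR0 hR using fun s => hF.exists_primitive hW hc (G.eval s)
  have h1 := hF.map_refl hc x
  have h1' := hF.map_refl hc y
  let vert : ∀ s s' u : I, Path (G (s, u)) (G (s', u)) := fun s s' u =>
    { toFun := fun r => G (Set.Icc.convexComb s s' r, u)
      continuous_toFun := G.continuous.comp
        ((Set.Icc.continuous_convexComb s s').prodMk continuous_const)
      source' := by simp
      target' := by simp }
  have step : ∀ k, R (t k) 1 = R (t (k + 1)) 1 := by
    intro k
    -- Primitives along consecutive rows of the grid differ by the vertical edge between them. This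
    -- propagates through one square at a time; at both ends the vertical edge is constant because
    -- the homotopy fixes endpoints.
    suffices ∀ m, R (t (k + 1)) (t m) = F (vert (t k) (t (k + 1)) (t m)) * R (t k) (t m) by
      have h2 := this n
      rw [hn] at h2
      rw [h2]
      have : F (vert (t k) (t (k + 1)) 1) = 1 := by
        rw [← h1']
        exact Path.dependent_congr F fun r => G.target _
      rw [this, one_mul]
    intro m
    induction m with
    | zero =>
      have : F (vert (t k) (t (k + 1)) 0) = 1 := by
        rw [← h1]
        exact Path.dependent_congr F fun r => G.source _
      rw [h0, this, hR0, hR0, one_mul]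
    | succ m ih =>
      obtain ⟨i, hi⟩ := h k m
      have hk := hm k.le_succ
      have hm' := hm m.le_succ
      rw [hR _ _ _ hm' ⟨i, fun v hv => hi ⟨⟨hk, le_rfl⟩, hv⟩⟩,
        hR _ _ _ hm' ⟨i, fun v hv => hi ⟨⟨le_rfl, hk⟩, hv⟩⟩, ih, ← mul_assoc, ← mul_assoc]
      congr 1
      let g : C(I × I, X) := ⟨fun v => G (Set.Icc.convexComb (t k) (t (k + 1)) v.1,
          Set.Icc.convexComb (t m) (t (m + 1)) v.2), G.continuous.comp
        (((Set.Icc.continuous_convexComb _ _).comp continuous_fst).prodMk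
          ((Set.Icc.continuous_convexComb _ _).comp continuous_snd))⟩
      have hsq := hF.square g (i := i) (fun v => hi
        ⟨⟨Set.Icc.le_convexComb hk _, Set.Icc.convexComb_le hk _⟩,
          ⟨Set.Icc.le_convexComb hm' _, Set.Icc.convexComb_le hm' _⟩⟩)
      convert hsq using 2
      · refine Path.dependent_congr F fun r => ?_
        change G _ = G _
        simp [unitPath]
      · refine Path.dependent_congr F fun r => ?_
        change G _ = G _
        simp [unitPath]
      · refine Path.dependent_congr F fun r => ?_
        change G _ = G _
        simp [unitPath]
      · refine Path.dependent_congr F fun r => ?_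
        change G _ = G _
        simp [unitPath]
  have h2 : ∀ k, R (t 0) 1 = R (t k) 1 := fun k => by
    induction k with
    | zero => rfl
    | succ k ih => rw [ih, step]
  have h3 := h2 n
  rw [h0, hn] at h3
  have h4 := hR 0
  have h5 := hR 1
  rw [G.eval_zero] at h4
  rw [G.eval_one] at h5
  rw [hP.unique h4 hW hc (by rw [hP0, hR0]), h3, hQ.unique h5 hW hc (by rw [hQ0, hR0])]

/-- **Existence part of the Seifert–van Kampen theorem**: a function on paths which is a cocycle
on each set of an open cover extends to a global cocycle. -/
theorem IsLocal.exists_cocycle (hF : IsLocal W F) (hW : ∀ i, IsOpen (W i))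
    (hc : ∀ x, ∃ i, x ∈ W i) :
    ∃ c : PathCocycle X H, ∀ i {x y : X} (p : Path x y), (∀ t, p t ∈ W i) → c p = F p := by
  choose R hR0 hR using fun (x y : X) (p : Path x y) => hF.exists_primitive hW hc p
  refine ⟨{ toFun := fun {a b} p => R a b p 1, map_trans' := ?_, map_homotopic' := ?_ }, ?_⟩
  · intro a b e p q
    have hhalf : (1 / 2 : ℝ) ∈ I := by constructor <;> norm_num
    let φ : I → I := fun t => ⟨(t : ℝ) / 2, by constructor <;> linarith [t.2.1, t.2.2]⟩
    let ψ : I → I := fun t => ⟨(1 + (t : ℝ)) / 2, by constructor <;> linarith [t.2.1, t.2.2]⟩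
    -- A primitive along `p.trans q`, read on the halves `t / 2` and `(1 + t) / 2`, is a primitive
    -- along `p` and along `q`. The second starts at the midpoint value, so uniqueness gives the
    -- product formula.
    have hφ : IsPrimitive W F p (fun t => R a e (p.trans q) (φ t)) := by
      refine (hR a e (p.trans q)).reparam φ ?_ ?_ ?_
      · intro s t hst
        have : (s : ℝ) ≤ t := hst
        change (s : ℝ) / 2 ≤ t / 2
        linarith
      · intro s t r
        apply Subtype.ext
        simp only [φ, Set.Icc.coe_convexComb]
        ring
      · intro t
        have : ((φ t : I) : ℝ) ≤ 1 / 2 := by simp only [φ]; linarith [t.2.2]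
        rw [Path.trans_apply, dif_pos this]
        congr 1
        apply Subtype.ext
        simp only [φ]
        ring
    have hψ : IsPrimitive W F q (fun t => R a e (p.trans q) (ψ t)) := by
      refine (hR a e (p.trans q)).reparam ψ ?_ ?_ ?_
      · intro s t hst
        have : (s : ℝ) ≤ t := hst
        change (1 + (s : ℝ)) / 2 ≤ (1 + t) / 2
        linarith
      · intro s t r
        apply Subtype.ext
        simp only [ψ, Set.Icc.coe_convexComb]
        ring
      · intro t
        have h2 : ((ψ t : I) : ℝ) = (1 + t) / 2 := rfl
        rcases eq_or_ne t 0 with rfl | h0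
        · have h3 : ψ 0 = ⟨1 / 2, hhalf⟩ := Subtype.ext (by simp [ψ])
          rw [h3, Path.trans_apply, dif_pos le_rfl, Path.source]
          refine p.target.symm.trans (congrArg p ?_)
          exact Subtype.ext (by simp)
        · have h : ¬ ((ψ t : I) : ℝ) ≤ 1 / 2 := by
            have : (0 : ℝ) < t := unitInterval.pos_iff_ne_zero.mpr h0
            linarith
          rw [Path.trans_apply, dif_neg h]
          congr 1
          apply Subtype.ext
          simp only [ψ]
          ring
    have hφ0 : φ 0 = 0 := Subtype.ext (by simp [φ])
    have hψ1 : ψ 1 = 1 := Subtype.ext (by simp [ψ])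
    have hφψ : φ 1 = ψ 0 := Subtype.ext (by simp [φ, ψ])
    have h1 := hφ.unique (hR a b p) hW hc (by rw [hφ0, hR0, hR0])
    have h2 := hψ.unique ((hR b e q).mul_right (R a e (p.trans q) (ψ 0))) hW hc
      (by simp [hR0])
    change R a e (p.trans q) 1 = R b e q 1 * R a b p 1
    rw [← h1, hφψ, ← h2, hψ1]
  · rintro a b p q ⟨G⟩
    exact IsLocal.homotopy_eq W F hF hW hc G (hR a b p) (hR a b q) (hR0 _ _ _) (hR0 _ _ _)
  · intro i a b p hp
    change R a b p 1 = F p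
    rw [hR a b p 0 1 zero_le_one ⟨i, fun v _ => hp v⟩, hR0, mul_one]
    exact Path.dependent_congr F fun r => by simp

end Local

/-- Two cocycles which agree on the paths in each set of an open cover are equal. -/
theorem ext_of_cover (c c' : PathCocycle X H) (W : ι → Set X) (hW : ∀ i, IsOpen (W i))
    (hc : ∀ x, ∃ i, x ∈ W i)
    (h : ∀ i {x y : X} (p : Path x y), (∀ t, p t ∈ W i) → c p = c' p) : c = c' := by
  ext x y p
  obtain ⟨t, h0, hm, ⟨n, hn⟩, hi⟩ := exists_partition hW hc p
  suffices ∀ n, c (p.subpath 0 (t n)) = c' (p.subpath 0 (t n)) by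
    have h1 := this n
    rw [hn] at h1
    have h2 : ∀ d : PathCocycle X H, d (p.subpath 0 1) = d p := fun d =>
      d.congr_path fun r => by simp
    rwa [h2, h2] at h1
  intro n
  induction n with
  | zero =>
    rw [h0, Path.subpath_self, map_refl, map_refl]
  | succ n ih =>
    obtain ⟨i, hi⟩ := hi n
    rw [c.map_subpath_trans p 0 (t n), c'.map_subpath_trans p 0 (t n), ih, h i]
    intro r
    exact hi _ ⟨Set.Icc.le_convexComb (hm n.le_succ) r, Set.Icc.convexComb_le (hm n.le_succ) r⟩

/-- Gluing of cocycles on two open sets covering the space. -/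
theorem exists_glue {U V : Set X} (hU : IsOpen U) (hV : IsOpen V) (hUV : ∀ x, x ∈ U ∨ x ∈ V)
    (cU : PathCocycle U H) (cV : PathCocycle V H)
    (h : ∀ {x y : X} (p : Path x y) (h1 : ∀ t, p t ∈ U) (h2 : ∀ t, p t ∈ V),
      cU (p.restrictTo h1) = cV (p.restrictTo h2)) :
    ∃ c : PathCocycle X H,
      (∀ {x y : X} (p : Path x y) (h1 : ∀ t, p t ∈ U), c p = cU (p.restrictTo h1)) ∧
      (∀ {x y : X} (p : Path x y) (h2 : ∀ t, p t ∈ V), c p = cV (p.restrictTo h2)) := by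
  classical
  -- The value 1 on paths contained in neither set is never used: locality only concerns paths
  -- inside `U` or inside `V`.
  let F : ∀ {a b : X}, Path a b → H := fun p =>
    if h1 : ∀ t, p t ∈ U then cU (p.restrictTo h1) else
    if h2 : ∀ t, p t ∈ V then cV (p.restrictTo h2) else 1
  have FU : ∀ {x y : X} (p : Path x y) (h1 : ∀ t, p t ∈ U), F p = cU (p.restrictTo h1) := by
    intro x y p h1
    simp only [F]
    rw [dif_pos h1]
  have FV : ∀ {x y : X} (p : Path x y) (h2 : ∀ t, p t ∈ V), F p = cV (p.restrictTo h2) := by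
    intro x y p h2
    by_cases h1 : ∀ t, p t ∈ U
    · rw [FU p h1, h p h1 h2]
    · simp only [F]
      rw [dif_neg h1, dif_pos h2]
  have hF : IsLocal (fun b : Bool => if b then U else V) F := by
    intro b
    cases b with
    | true => exact ⟨cU, fun p h1 => FU p h1⟩
    | false => exact ⟨cV, fun p h2 => FV p h2⟩
  obtain ⟨c, hc⟩ := hF.exists_cocycle (by rintro (_ | _); exacts [hV, hU])
    (fun x => (hUV x).elim (fun h => ⟨true, h⟩) (fun h => ⟨false, h⟩))
  exact ⟨c, fun p h1 => (hc true p h1).trans (FU p h1), fun p h2 => (hc false p h2).trans (FV p h2)⟩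

end PathCocycle

/-! ### Van Kampen's theorem for closed pieces with a collar -/

/-- Pasting of continuous maps on two closed pieces. -/
theorem exists_paste {P Q Z Y : Type*} [TopologicalSpace P] [TopologicalSpace Q]
    [TopologicalSpace Z] [TopologicalSpace Y] {a : P → Z} {b : Q → Z} (ha : IsClosedEmbedding a)
    (hb : IsClosedEmbedding b) (hab : ∀ z, z ∈ Set.range a ∨ z ∈ Set.range b) (f : C(P, Y))
    (g : C(Q, Y)) (h : ∀ p q, a p = b q → f p = g q) :
    ∃ k : C(Z, Y), (∀ p, k (a p) = f p) ∧ ∀ q, k (b q) = g q := by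
  have hq : IsQuotientMap (Sum.elim a b) := by
    refine IsClosedMap.isQuotientMap ?_ (ha.continuous.sumElim hb.continuous) ?_
    · exact isClosedMap_sum.mpr ⟨ha.isClosedMap, hb.isClosedMap⟩
    · intro z
      rcases hab z with ⟨p, rfl⟩ | ⟨q, rfl⟩
      exacts [⟨Sum.inl p, rfl⟩, ⟨Sum.inr q, rfl⟩]
  let F : C(P ⊕ Q, Y) := ⟨Sum.elim f g, f.continuous.sumElim g.continuous⟩
  let E : C(P ⊕ Q, Z) := ⟨Sum.elim a b, hq.continuous⟩
  have hF : Function.FactorsThrough F E := by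
    rintro (p | p) (q | q) hpq
    · exact congrArg f (ha.injective hpq)
    · exact h p q hpq
    · exact (h q p hpq.symm).symm
    · exact congrArg g (hb.injective hpq)
  have hE : IsQuotientMap E := hq
  refine ⟨hE.lift F hF, fun p => ?_, fun q => ?_⟩
  · exact congrArg (fun k : C(P ⊕ Q, Y) => k (Sum.inl p)) (hE.lift_comp F hF)
  · exact congrArg (fun k : C(P ⊕ Q, Y) => k (Sum.inr q)) (hE.lift_comp F hF)

/-- Naturality of a cocycle with respect to a homotopy. -/
theorem PathCocycle.map_homotopy {X Y H : Type*} [TopologicalSpace X] [TopologicalSpace Y]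
    [Group H] (c : PathCocycle X H) (k : C(Y × I, X)) {x y : Y} (p : Path x y) :
    c ((p.prod (Path.refl 1)).map k.continuous) *
      c (((Path.refl x).prod unitPath).map k.continuous) =
    c (((Path.refl y).prod unitPath).map k.continuous) *
      c ((p.prod (Path.refl 0)).map k.continuous) := by
  have h1 := (c.comap k).map_prod p unitPath
  have h2 := (c.comap k).map_prod' p unitPath
  exact h2.symm.trans h1

/-- A decomposition of `X` as the union of two closed pieces `A` and `B` along `T`, together with
an open collar `T × [0, ∞)` of `T` in `B`. -/
structure CollaredPushout (X A B T : Type*) [TopologicalSpace X] [TopologicalSpace A]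
    [TopologicalSpace B] [TopologicalSpace T] where
  iA : C(A, X)
  iB : C(B, X)
  τA : C(T, A)
  τB : C(T, B)
  collar : C(T × NNReal, B)
  isClosedEmbedding_iA : IsClosedEmbedding iA
  isClosedEmbedding_iB : IsClosedEmbedding iB
  cover : ∀ x, x ∈ Set.range iA ∨ x ∈ Set.range iB
  comm : ∀ t, iA (τA t) = iB (τB t)
  glue : ∀ a b, iA a = iB b → ∃ t, a = τA t ∧ b = τB t
  isOpenEmbedding_collar : IsOpenEmbedding collar
  collar_zero : ∀ t, collar (t, 0) = τB t

namespace CollaredPushout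

variable {X A B T H : Type*} [TopologicalSpace X] [TopologicalSpace A]
    [TopologicalSpace B] [TopologicalSpace T] [Group H] (D : CollaredPushout X A B T)

/-- The union of `A` and the open collar. -/
def U : Set X := (D.iB '' (Set.range D.collar)ᶜ)ᶜ

/-- The complement of `A`. -/
def V : Set X := (Set.range D.iA)ᶜ

theorem isOpen_U : IsOpen D.U :=
  (D.isClosedEmbedding_iB.isClosedMap _ D.isOpenEmbedding_collar.isOpen_range.isClosed_compl).isOpen_compl

theorem isOpen_V : IsOpen D.V := D.isClosedEmbedding_iA.isClosed_range.isOpen_compl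

theorem iA_mem_U (a : A) : D.iA a ∈ D.U := by
  rintro ⟨b, hb, hab⟩
  obtain ⟨t, -, rfl⟩ := D.glue a b hab.symm
  exact hb ⟨(t, 0), D.collar_zero t⟩

theorem iB_mem_U_iff (b : B) : D.iB b ∈ D.U ↔ b ∈ Set.range D.collar := by
  constructor
  · intro h
    by_contra hb
    exact h ⟨b, hb, rfl⟩
  · rintro hb ⟨b', hb', h⟩
    rw [D.isClosedEmbedding_iB.injective h] at hb'
    exact hb' hb

theorem U_or_V (x : X) : x ∈ D.U ∨ x ∈ D.V := by
  by_cases h : x ∈ D.V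
  · exact Or.inr h
  · obtain ⟨a, rfl⟩ := not_not.mp h
    exact Or.inl (D.iA_mem_U a)

theorem V_subset {x : X} (h : x ∈ D.V) : x ∈ Set.range D.iB := (D.cover x).resolve_left h

/-- The inclusion of `A` into `U`. -/
def jA : C(A, D.U) := ⟨fun a => ⟨D.iA a, D.iA_mem_U a⟩, D.iA.continuous.subtype_mk _⟩

/-- The inclusion of the collar into `U`. -/
def jC : C(T × NNReal, D.U) :=
  ⟨fun v => ⟨D.iB (D.collar v), (D.iB_mem_U_iff _).mpr ⟨v, rfl⟩⟩,
    (D.iB.continuous.comp D.collar.continuous).subtype_mk _⟩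

theorem isClosedEmbedding_jA : IsClosedEmbedding D.jA := by
  refine ⟨D.isClosedEmbedding_iA.isEmbedding.codRestrict _ _, ?_⟩
  have : Set.range D.jA = Subtype.val ⁻¹' (Set.range D.iA) := by
    ext ⟨x, hx⟩
    constructor
    · rintro ⟨a, ha⟩; exact ⟨a, congrArg Subtype.val ha⟩
    · rintro ⟨a, ha⟩; exact ⟨a, Subtype.ext ha⟩
  rw [this]
  exact D.isClosedEmbedding_iA.isClosed_range.preimage continuous_subtype_val

theorem isClosedEmbedding_jC : IsClosedEmbedding D.jC := by
  refine ⟨(D.isClosedEmbedding_iB.isEmbedding.comp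
    D.isOpenEmbedding_collar.isEmbedding).codRestrict _ _, ?_⟩
  have : Set.range D.jC = Subtype.val ⁻¹' (Set.range D.iB) := by
    ext ⟨x, hx⟩
    constructor
    · rintro ⟨v, hv⟩; exact ⟨D.collar v, congrArg Subtype.val hv⟩
    · rintro ⟨b, rfl⟩
      obtain ⟨v, rfl⟩ := (D.iB_mem_U_iff _).mp hx
      exact ⟨v, rfl⟩
  rw [this]
  exact D.isClosedEmbedding_iB.isClosed_range.preimage continuous_subtype_val

theorem cover_U (x : D.U) : x ∈ Set.range D.jA ∨ x ∈ Set.range D.jC := by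
  obtain ⟨x, hx⟩ := x
  rcases D.cover x with ⟨a, rfl⟩ | ⟨b, rfl⟩
  · exact Or.inl ⟨a, rfl⟩
  · obtain ⟨v, rfl⟩ := (D.iB_mem_U_iff _).mp hx
    exact Or.inr ⟨v, rfl⟩

/-- Inside `U` the two closed pieces meet only in `T`, the zero level of the collar; this is the
compatibility needed to paste the retraction and the deformation. -/
theorem jA_eq_jC {a : A} {v : T × NNReal} (h : D.jA a = D.jC v) : a = D.τA v.1 ∧ v.2 = 0 := by
  obtain ⟨t, h1, h2⟩ := D.glue a _ (congrArg Subtype.val h)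
  rw [← D.collar_zero] at h2
  rw [D.isOpenEmbedding_collar.injective h2]
  exact ⟨h1, rfl⟩

/-- The retraction of `U` onto `A` along the collar. -/
theorem exists_retraction :
    ∃ r : C(D.U, A), (∀ a, r (D.jA a) = a) ∧ ∀ v, r (D.jC v) = D.τA v.1 :=
  exists_paste D.isClosedEmbedding_jA D.isClosedEmbedding_jC D.cover_U (ContinuousMap.id A)
    (D.τA.comp ContinuousMap.fst) fun _ _ h => (D.jA_eq_jC h).1

/-- The deformation of `U` into `A` along the collar. -/
theorem exists_deformation :
    ∃ κ : C(D.U × I, X), (∀ a s, κ (D.jA a, s) = D.iA a) ∧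
      ∀ v s, κ (D.jC v, s) = D.iB (D.collar (v.1, v.2 * unitInterval.toNNReal (σ s))) := by
  let f : C(A × I, X) := ⟨fun w => D.iA w.1, by fun_prop⟩
  let g : C((T × NNReal) × I, X) := ⟨fun w =>
    D.iB (D.collar (w.1.1, w.1.2 * unitInterval.toNNReal (σ w.2))), by fun_prop⟩
  have hcov : ∀ z, z ∈ Set.range (Prod.map D.jA (id : I → I)) ∨
      z ∈ Set.range (Prod.map D.jC (id : I → I)) := by
    rintro ⟨x, s⟩
    rcases D.cover_U x with ⟨a, rfl⟩ | ⟨v, rfl⟩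
    exacts [Or.inl ⟨(a, s), rfl⟩, Or.inr ⟨(v, s), rfl⟩]
  have hfg : ∀ p q, Prod.map D.jA (id : I → I) p = Prod.map D.jC (id : I → I) q → f p = g q := by
    rintro ⟨a, s⟩ ⟨v, s'⟩ h
    obtain ⟨h1, h2⟩ := D.jA_eq_jC (congrArg Prod.fst h)
    simp only [f, g, ContinuousMap.coe_mk, h2, zero_mul, D.collar_zero, h1, D.comm]
  obtain ⟨κ, h1, h2⟩ := exists_paste (D.isClosedEmbedding_jA.prodMap IsClosedEmbedding.id)
    (D.isClosedEmbedding_jC.prodMap IsClosedEmbedding.id) hcov f g hfg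
  exact ⟨κ, fun a s => h1 (a, s), fun v s => h2 (v, s)⟩

/-- The track of a point under the collar. -/
def track (v : T × NNReal) : Path ((v.1, 0) : T × NNReal) v where
  toFun s := (v.1, v.2 * unitInterval.toNNReal s)
  continuous_toFun := by fun_prop
  source' := by simp
  target' := by simp

/-- The retraction of the collar along its fibres. -/
def collarContraction : C((T × NNReal) × I, T × NNReal) :=
  ⟨fun v => (v.1.1, v.1.2 * unitInterval.toNNReal v.2), by fun_prop⟩

/-- Naturality with respect to the contraction of the collar onto its zero level: a path is its
projection to `T`, corrected at both ends by the fibre tracks. -/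
theorem map_collar (d : PathCocycle (T × NNReal) H) {v w : T × NNReal} (p : Path v w) :
    d p = d (track w) * d ((p.map continuous_fst).prod (Path.refl 0)) * (d (track v))⁻¹ := by
  rw [eq_mul_inv_iff_mul_eq]
  have h := d.map_homotopy collarContraction p
  convert h using 2
  · refine d.congr_path fun s => ?_
    change p s = ((p s).1, (p s).2 * unitInterval.toNNReal 1)
    simp
  · exact d.congr_path fun s => rfl
  · exact d.congr_path fun s => rfl
  · refine d.congr_path fun s => ?_
    change ((p s).1, 0) = ((p s).1, (p s).2 * unitInterval.toNNReal 0)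
    simp

/-- Cocycles on the two pieces which agree on the intersection glue. -/
theorem exists_glue (cA : PathCocycle A H) (cB : PathCocycle B H)
    (h : cA.comap D.τA = cB.comap D.τB) :
    ∃ c : PathCocycle X H, c.comap D.iA = cA ∧ c.comap D.iB = cB := by
  classical
  obtain ⟨r, hrA, hrC⟩ := D.exists_retraction
  let d : PathCocycle (T × NNReal) H := cB.comap D.collar
  -- Pulling `cA` back along the retraction of `U` forgets what `cB` does along the collar fibres.
  -- Gauging by the transport of `cB` along the fibre restores it, and changes nothing on `A`.
  let g : D.U → H := fun x => if h : ∃ v, D.jC v = x then d (track h.choose) else 1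
  have hgC : ∀ v, g (D.jC v) = d (track v) := by
    intro v
    have h : ∃ w, D.jC w = D.jC v := ⟨v, rfl⟩
    have h2 := D.isClosedEmbedding_jC.injective h.choose_spec
    simp only [g]
    rw [dif_pos h, h2]
  have hgA : ∀ a, g (D.jA a) = 1 := by
    intro a
    by_cases h : ∃ v, D.jC v = D.jA a
    · obtain ⟨v, hv⟩ := h
      have h2 := (D.jA_eq_jC hv.symm).2
      rw [← hv, hgC]
      exact d.congr_path (q := Path.refl v) (fun s => by
        change (v.1, v.2 * _) = v
        rw [h2, zero_mul, ← h2]) |>.trans (d.map_refl v)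
    · exact dif_neg h
  let cU : PathCocycle D.U H := (cA.comap r).gauge g
  have hUC : ∀ {v w : T × NNReal} (p : Path v w), cU (p.map D.jC.continuous) = d p := by
    intro v w p
    rw [map_collar]
    change g _ * cA ((p.map D.jC.continuous).map r.continuous) * (g _)⁻¹ = _
    rw [hgC, hgC]
    congr 2
    have h2 : cA.comap D.τA (p.map continuous_fst) = cB.comap D.τB (p.map continuous_fst) := by
      rw [h]
    refine (cA.congr_path fun s => ?_).trans (h2.trans (cB.congr_path fun s => ?_))
    · exact hrC _
    · exact (D.collar_zero _).symm
  have hUA : ∀ {a a' : A} (p : Path a a'), cU (p.map D.jA.continuous) = cA p := by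
    intro a a' p
    change g _ * cA ((p.map D.jA.continuous).map r.continuous) * (g _)⁻¹ = _
    rw [hgA, hgA, one_mul, inv_one, mul_one]
    exact cA.congr_path fun s => hrA _
  let eB : B ≃ₜ Set.range D.iB := D.isClosedEmbedding_iB.isEmbedding.toHomeomorph
  let jV : C(D.V, B) := ⟨fun x => eB.symm ⟨x.1, D.V_subset x.2⟩, by fun_prop⟩
  have hjV : ∀ x, D.iB (jV x) = x.1 := fun x =>
    congrArg Subtype.val (eB.apply_symm_apply ⟨x.1, D.V_subset x.2⟩)
  have hUV : ∀ {x y : X} (p : Path x y) (h1 : ∀ t, p t ∈ D.U) (h2 : ∀ t, p t ∈ D.V),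
      cU (p.restrictTo h1) = cB.comap jV (p.restrictTo h2) := by
    intro x y p h1 h2
    let eC : (T × NNReal) ≃ₜ Set.range D.jC := D.isClosedEmbedding_jC.isEmbedding.toHomeomorph
    have h3 : ∀ t, (p.restrictTo h1) t ∈ Set.range D.jC := by
      intro t
      refine (D.cover_U _).resolve_left ?_
      rintro ⟨a, ha⟩
      exact h2 t ⟨a, congrArg Subtype.val ha⟩
    let p' := ((p.restrictTo h1).restrictTo h3).map eC.symm.continuous
    have hp' : ∀ t, D.jC (p' t) = p.restrictTo h1 t := fun t =>
      congrArg Subtype.val (eC.apply_symm_apply ⟨_, h3 t⟩)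
    rw [← cU.congr_path (p := p'.map D.jC.continuous) hp', hUC]
    refine cB.congr_path fun t => D.isClosedEmbedding_iB.injective ?_
    change D.iB (D.collar (p' t)) = D.iB (jV _)
    rw [hjV]
    exact congrArg Subtype.val (hp' t)
  obtain ⟨c, hcU, hcV⟩ := PathCocycle.exists_glue D.isOpen_U D.isOpen_V D.U_or_V cU
    (cB.comap jV) hUV
  refine ⟨c, ?_, ?_⟩
  · ext a a' p
    change c (p.map D.iA.continuous) = _
    rw [hcU _ (fun t => D.iA_mem_U _), ← hUA p]
    exact cU.congr_path fun t => rfl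
  -- On `B` the glued cocycle is known only over `U` and over `V`, so equality with `cB` is checked
  -- on the open cover of `B` by the collar and the complement of `A`.
  · refine PathCocycle.ext_of_cover _ _ (fun b : Bool => D.iB ⁻¹' (if b then D.U else D.V)) ?_ ?_ ?_
    · rintro (_ | _)
      exacts [D.isOpen_V.preimage D.iB.continuous, D.isOpen_U.preimage D.iB.continuous]
    · intro b
      rcases D.U_or_V (D.iB b) with h | h
      exacts [⟨true, h⟩, ⟨false, h⟩]
    · rintro (_ | _) x y p hp
      · change c (p.map D.iB.continuous) = _
        rw [hcV _ hp]
        exact cB.congr_path fun t => D.isClosedEmbedding_iB.injective (hjV _)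
      · change c (p.map D.iB.continuous) = _
        have h3 : ∀ t, p t ∈ Set.range D.collar := fun t => (D.iB_mem_U_iff _).mp (hp t)
        let eC : (T × NNReal) ≃ₜ Set.range D.collar :=
          D.isOpenEmbedding_collar.isEmbedding.toHomeomorph
        let p' := (p.restrictTo h3).map eC.symm.continuous
        have hp' : ∀ t, D.collar (p' t) = p t := fun t =>
          congrArg Subtype.val (eC.apply_symm_apply ⟨_, h3 t⟩)
        rw [hcU _ hp, ← cB.congr_path (p := p'.map D.collar.continuous) hp']
        change _ = d p'
        rw [← hUC]
        refine cU.congr_path fun t => Subtype.ext ?_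
        exact congrArg D.iB (hp' t).symm

/-- Cocycles on `X` are determined by their restrictions to the two pieces. -/
theorem ext_cocycle (c c' : PathCocycle X H) (hA : c.comap D.iA = c'.comap D.iA)
    (hB : c.comap D.iB = c'.comap D.iB) : c = c' := by
  obtain ⟨r, hrA, hrC⟩ := D.exists_retraction
  obtain ⟨κ, hκA, hκC⟩ := D.exists_deformation
  have hA' : ∀ {x y : A} (p : Path x y),
      c (p.map D.iA.continuous) = c' (p.map D.iA.continuous) := by
    intro x y p
    change c.comap D.iA p = c'.comap D.iA p
    rw [hA]
  have hB' : ∀ {x y : B} (p : Path x y),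
      c (p.map D.iB.continuous) = c' (p.map D.iB.continuous) := by
    intro x y p
    change c.comap D.iB p = c'.comap D.iB p
    rw [hB]
  have hκ0 : ∀ x : D.U, κ (x, 0) = x.1 := by
    intro x
    rcases D.cover_U x with ⟨a, rfl⟩ | ⟨v, rfl⟩
    · rw [hκA]; rfl
    · rw [hκC]; simp; rfl
  have hκ1 : ∀ x : D.U, κ (x, 1) = D.iA (r x) := by
    intro x
    rcases D.cover_U x with ⟨a, rfl⟩ | ⟨v, rfl⟩
    · rw [hκA, hrA]
    · rw [hκC, hrC]; simp [D.collar_zero, D.comm]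
  -- The track of a point under the deformation is constant on `A` and lies in `B` otherwise, so
  -- both cocycles agree on it. Naturality then reduces a path in `U` to a path in `A`.
  have htrack : ∀ x : D.U,
      c (((Path.refl x).prod PathCocycle.unitPath).map κ.continuous) =
      c' (((Path.refl x).prod PathCocycle.unitPath).map κ.continuous) := by
    intro x
    rcases D.cover_U x with ⟨a, rfl⟩ | ⟨v, rfl⟩
    · have : ∀ d : PathCocycle X H,
        d (((Path.refl (D.jA a)).prod PathCocycle.unitPath).map κ.continuous) = 1 := fun d =>
        d.map_const _ fun s => (hκA a _).trans (hκA a _).symm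
      rw [this, this]
    · have : ∀ d : PathCocycle X H,
        d (((Path.refl (D.jC v)).prod PathCocycle.unitPath).map κ.continuous) =
        d (((track v).symm.map D.collar.continuous).map D.iB.continuous) := fun d =>
        d.congr_path fun s => hκC v _
      rw [this, this, hB']
  refine PathCocycle.ext_of_cover _ _ (fun b : Bool => if b then D.U else D.V) ?_ ?_ ?_
  · rintro (_ | _)
    exacts [D.isOpen_V, D.isOpen_U]
  · intro b
    rcases D.U_or_V b with h | h
    exacts [⟨true, h⟩, ⟨false, h⟩]
  · rintro (_ | _) x y p hp
    · let eB : B ≃ₜ Set.range D.iB := D.isClosedEmbedding_iB.isEmbedding.toHomeomorph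
      let p' := (p.restrictTo (fun t => D.V_subset (hp t))).map eB.symm.continuous
      have hp' : ∀ t, D.iB (p' t) = p t := fun t =>
        congrArg Subtype.val (eB.apply_symm_apply ⟨_, D.V_subset (hp t)⟩)
      rw [← c.congr_path (p := p'.map D.iB.continuous) hp',
        ← c'.congr_path (p := p'.map D.iB.continuous) hp', hB']
    · have h1 := c.map_homotopy κ (p.restrictTo hp)
      have h2 := c'.map_homotopy κ (p.restrictTo hp)
      rw [htrack, htrack] at h1
      have h3 : ∀ d : PathCocycle X H,
          d (((p.restrictTo hp).prod (Path.refl 0)).map κ.continuous) = d p := fun d =>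
        d.congr_path fun s => hκ0 _
      have h4 : ∀ d : PathCocycle X H,
          d (((p.restrictTo hp).prod (Path.refl 1)).map κ.continuous) =
          d (((p.restrictTo hp).map r.continuous).map D.iA.continuous) := fun d =>
        d.congr_path fun s => hκ1 _
      rw [h3, h4] at h1 h2
      rw [hA', h2] at h1
      exact (mul_left_cancel h1).symm

end CollaredPushout

/-! ### Loops in the circle and in the torus -/

namespace PathCocycle

variable {X Y H : Type*} [TopologicalSpace X] [TopologicalSpace Y] [Group H]

theorem eq_of_simplyConnected [SimplyConnectedSpace X] (c : PathCocycle X H) {x y : X}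
    (p q : Path x y) : c p = c q :=
  c.map_homotopic (SimplyConnectedSpace.paths_homotopic p q)

/-- The straight path in `ℝ`. -/
def linePath (x y : ℝ) : Path x y where
  toFun t := x + t * (y - x)
  continuous_toFun := by fun_prop
  source' := by simp
  target' := by simp

/-- After pullback along the exponential, paths in the simply connected line matter only through
their endpoints, and each further period contributes one factor. -/
theorem circle_zpow (c : PathCocycle Circle H) (n : ℤ) :
    c ((linePath 0 (2 * Real.pi * n)).map Circle.exp.continuous) =
      c (circleLoop (ContinuousMap.id Circle)) ^ n := by
  have hstep : ∀ m : ℤ, c.comap Circle.exp (linePath 0 (2 * Real.pi * (m + 1 : ℤ))) =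
      c (circleLoop (ContinuousMap.id Circle)) *
        c.comap Circle.exp (linePath 0 (2 * Real.pi * m)) := by
    intro m
    rw [eq_of_simplyConnected _ (linePath 0 (2 * Real.pi * (m + 1 : ℤ)))
      ((linePath 0 (2 * Real.pi * m)).trans (linePath _ _)), map_trans]
    congr 1
    refine c.congr_path fun t => ?_
    change Circle.exp (2 * Real.pi * m + t * (2 * Real.pi * (m + 1 : ℤ) - 2 * Real.pi * m)) =
      Circle.exp (2 * Real.pi * t)
    have : 2 * Real.pi * m + t * (2 * Real.pi * (m + 1 : ℤ) - 2 * Real.pi * m) =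
        2 * Real.pi * t + m * (2 * Real.pi) := by
      push_cast
      ring
    rw [this, Circle.exp_add, Circle.exp_int_mul_two_pi, mul_one]
  change c.comap Circle.exp (linePath 0 (2 * Real.pi * n)) = _
  induction n using Int.induction_on with
  | zero =>
    rw [zpow_zero, eq_of_simplyConnected _ _ ((Path.refl 0).cast rfl (by simp))]
    exact map_const _ _ fun t => rfl
  | succ k ih => rw [hstep, ih, add_comm, zpow_add, zpow_one]
  | pred k ih =>
    have h := hstep (-k - 1)
    rw [sub_add_cancel, ih] at h
    refine mul_left_cancel (a := c (circleLoop (ContinuousMap.id Circle))) ?_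
    rw [← h, ← zpow_one_add]
    congr 1
    ring

/-- Every loop in the circle is homotopic to a power of the standard loop. -/
theorem circle_loop (p : Path (1 : Circle) 1) : ∃ n : ℤ, ∀ {H : Type*} [Group H]
    (c : PathCocycle Circle H), c p = c (circleLoop (ContinuousMap.id Circle)) ^ n := by
  -- The exponent is the winding number, read from the endpoint of a lift to the line. It is
  -- independent of the cocycle, so one exponent serves any two cocycles being compared.
  let Γ := Circle.isCoveringMap_exp.liftPath p.toContinuousMap 0 (by simp)
  have h1 : ∀ t, Circle.exp (Γ t) = p t := fun t =>
    congrFun (Circle.isCoveringMap_exp.liftPath_lifts p.toContinuousMap 0 (by simp)) t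
  have h0 : Γ 0 = 0 := Circle.isCoveringMap_exp.liftPath_zero p.toContinuousMap 0 (by simp)
  have h2 : Circle.exp (Γ 1) = 1 := by rw [h1, p.target]
  obtain ⟨n, hn⟩ := Circle.exp_eq_one.mp h2
  refine ⟨n, fun c => ?_⟩
  rw [← circle_zpow]
  let γ : Path (0 : ℝ) (2 * Real.pi * n) :=
    { toFun := Γ, continuous_toFun := Γ.continuous, source' := h0,
      target' := by rw [mul_comm]; exact hn }
  rw [← c.congr_path (p := γ.map Circle.exp.continuous) h1]
  exact (c.comap Circle.exp).eq_of_simplyConnected _ _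

theorem circle_ext (c c' : PathCocycle Circle H)
    (h : c (circleLoop (ContinuousMap.id Circle)) = c' (circleLoop (ContinuousMap.id Circle)))
    (p : Path (1 : Circle) 1) : c p = c' p := by
  obtain ⟨n, hn⟩ := circle_loop p
  rw [hn, hn, h]

/-- The inclusion of the first circle in the torus. -/
noncomputable def torusLong : C(Circle, Circle × Circle) := ⟨fun z => (z, 1), by fun_prop⟩

/-- The inclusion of the second circle in the torus. -/
noncomputable def torusMer : C(Circle, Circle × Circle) := ⟨fun w => (1, w), by fun_prop⟩

/-- Cocycles on the torus are determined on loops by the values on the two standard loops. -/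
theorem torus_ext (c c' : PathCocycle (Circle × Circle) H)
    (hl : c (circleLoop torusLong) = c' (circleLoop torusLong))
    (hm : c (circleLoop torusMer) = c' (circleLoop torusMer))
    (p : Path ((1 : Circle), (1 : Circle)) (1, 1)) : c p = c' p := by
  have key : ∀ d : PathCocycle (Circle × Circle) H, d p =
      d.comap torusMer (p.map continuous_snd) * d.comap torusLong (p.map continuous_fst) := by
    intro d
    refine (d.map_prod (p.map continuous_fst) (p.map continuous_snd)).trans ?_
    rfl
  rw [key c, key c']
  congr 1
  · exact circle_ext _ _ hm _
  · exact circle_ext _ _ hl _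

/-- Cocycles on a solid torus are determined on loops by the value on the core. -/
theorem prod_simplyConnected_ext [SimplyConnectedSpace Y] (c c' : PathCocycle (Circle × Y) H)
    (y : Y) (h : c (circleLoop ⟨fun z => (z, y), by fun_prop⟩) =
      c' (circleLoop ⟨fun z => (z, y), by fun_prop⟩))
    (p : Path ((1 : Circle), y) (1, y)) : c p = c' p := by
  have key : ∀ d : PathCocycle (Circle × Y) H, d p =
      d.comap ⟨fun z => (z, y), by fun_prop⟩ (p.map continuous_fst) := by
    intro d
    refine (d.map_prod (p.map continuous_fst) (p.map continuous_snd)).trans ?_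
    have h1 : d ((Path.refl (1 : Circle)).prod (p.map continuous_snd)) =
        (d.comap ⟨fun y => ((1 : Circle), y), by fun_prop⟩) (p.map continuous_snd) := rfl
    rw [h1, eq_of_simplyConnected _ (p.map continuous_snd) (Path.refl y), map_refl, one_mul]
    rfl
  rw [key c, key c']
  exact circle_ext _ _ h _

/-- The value of a cocycle on a closed curve is unchanged by a free homotopy, up to conjugation. -/
theorem circleLoop_homotopy (c : PathCocycle X H) (k : C(Circle × I, X)) :
    ∃ h : H, c (circleLoop ⟨fun z => k (z, 1), by fun_prop⟩) =
      h * c (circleLoop ⟨fun z => k (z, 0), by fun_prop⟩) * h⁻¹ := by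
  exact ⟨_, eq_mul_inv_of_mul_eq (c.map_homotopy k (circleLoop (ContinuousMap.id Circle)))⟩

/-- A space which is the union of two simply connected open sets with path connected intersection
has no nontrivial cocycles. -/
theorem trivial_of_cover {U V : Set X} (hU : IsOpen U) (hV : IsOpen V)
    (hUV : ∀ x, x ∈ U ∨ x ∈ V) [SimplyConnectedSpace U] [SimplyConnectedSpace V]
    (hc : IsPathConnected (U ∩ V)) (c : PathCocycle X H) {x : X} (p : Path x x) : c p = 1 := by
  classical
  obtain ⟨o, ho, hj⟩ := hc
  let cU := c.comap ⟨(Subtype.val : U → X), continuous_subtype_val⟩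
  let cV := c.comap ⟨(Subtype.val : V → X), continuous_subtype_val⟩
  -- Transport from `o` inside `U` or inside `V`. A path in the connected intersection computes
  -- both, so the choices agree there and `c` is a gauge of the trivial cocycle.
  let g : X → H := fun x => if h : x ∈ U then
    cU (PathConnectedSpace.somePath (⟨o, ho.1⟩ : U) ⟨x, h⟩) else if h : x ∈ V then
    cV (PathConnectedSpace.somePath (⟨o, ho.2⟩ : V) ⟨x, h⟩) else 1
  have hgU : ∀ {x : X} (p : Path o x), (∀ t, p t ∈ U) → g x = c p := by
    intro x p hp
    have hx : x ∈ U := by simpa using hp 1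
    simp only [g]
    rw [dif_pos hx, cU.eq_of_simplyConnected _ (p.restrictTo hp)]
    exact c.congr_path fun t => rfl
  have hgV : ∀ {x : X} (p : Path o x), (∀ t, p t ∈ V) → g x = c p := by
    intro x p hp
    have hx : x ∈ V := by simpa using hp 1
    by_cases hxU : x ∈ U
    · obtain ⟨q, hq⟩ := hj ⟨hxU, hx⟩
      rw [hgU q (fun t => (hq t).1)]
      have := cV.eq_of_simplyConnected (q.restrictTo fun t => (hq t).2) (p.restrictTo hp)
      exact (c.congr_path fun t => rfl).trans (this.trans (c.congr_path fun t => rfl))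
    · simp only [g]
      rw [dif_neg hxU, dif_pos hx, cV.eq_of_simplyConnected _ (p.restrictTo hp)]
      exact c.congr_path fun t => rfl
  have htr : ∀ {x y z : X} {W : Set X} (p : Path x y) (q : Path y z), (∀ t, p t ∈ W) →
      (∀ t, q t ∈ W) → ∀ t, p.trans q t ∈ W := by
    intro x y z W p q hp hq t
    rw [Path.trans_apply]
    split_ifs
    exacts [hp _, hq _]
  have h : c = (trivial X H).gauge g := by
    refine ext_of_cover _ _ (fun b : Bool => if b then U else V) ?_ ?_ ?_
    · rintro (_ | _)
      exacts [hV, hU]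
    · intro x
      rcases hUV x with h | h
      exacts [⟨true, h⟩, ⟨false, h⟩]
    · rintro (_ | _) x y p hp
      · let q : Path (⟨o, ho.2⟩ : V) ⟨x, by simpa using hp 0⟩ := PathConnectedSpace.somePath _ _
        let q' : Path o x := q.map continuous_subtype_val
        have hq : ∀ t, q' t ∈ V := fun t => (q t).2
        rw [gauge_apply, trivial_apply, hgV q' hq, hgV (q'.trans p) (htr _ _ hq hp), map_trans]
        group
      · let q : Path (⟨o, ho.1⟩ : U) ⟨x, by simpa using hp 0⟩ := PathConnectedSpace.somePath _ _
        let q' : Path o x := q.map continuous_subtype_val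
        have hq : ∀ t, q' t ∈ U := fun t => (q t).2
        rw [gauge_apply, trivial_apply, hgU q' hq, hgU (q'.trans p) (htr _ _ hq hp), map_trans]
        group
  rw [h, gauge_apply, trivial_apply]
  group

end PathCocycle

theorem simplyConnectedSpace_compl_singleton (v : S3) :
    SimplyConnectedSpace ({v}ᶜ : Set S3) := by
  have h := isOpenEmbedding_stereographic_symm (norm_eq_of_mem_sphere v)
  have e := h.isEmbedding.toHomeomorph
  rw [range_stereographic_symm] at e
  exact e.symm.toHomotopyEquiv.simplyConnectedSpace

/-- Cocycles on the `3`-sphere are trivial on loops. -/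
theorem PathCocycle.sphere_trivial {H : Type*} [Group H] (c : PathCocycle S3 H) {x : S3}
    (p : Path x x) : c p = 1 := by
  have := simplyConnectedSpace_compl_singleton x
  have := simplyConnectedSpace_compl_singleton (-x)
  have hx : (-x : S3) ≠ x := fun h => ne_neg_of_mem_unit_sphere ℝ x h.symm
  refine trivial_of_cover (U := {x}ᶜ) (V := {-x}ᶜ) isOpen_compl_singleton isOpen_compl_singleton
    ?_ ?_ c p
  · intro y
    by_contra h
    simp only [Set.mem_compl_iff, Set.mem_singleton_iff, not_or, not_not] at h
    exact hx (h.2.symm.trans h.1)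
  -- Stereographic projection from `x` sends `-x` to the origin, so the intersection is a
  -- three-dimensional space minus a point.
  · have hrank : 1 < Module.rank ℝ (ℝ ∙ (x : EuclideanSpace ℝ (Fin 4)))ᗮ := by
      have : Fact (Module.finrank ℝ (EuclideanSpace ℝ (Fin 4)) = 3 + 1) := ⟨by simp⟩
      rw [← Module.finrank_eq_rank, Submodule.finrank_orthogonal_span_singleton (n := 3)
        (ne_zero_of_mem_unit_sphere x)]
      norm_num
    have h1 := isPathConnected_compl_singleton_of_one_lt_rank hrank 0
    have h := isOpenEmbedding_stereographic_symm (norm_eq_of_mem_sphere x)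
    have h2 := h1.image h.continuous
    convert h2 using 1
    have h3 : (stereographic (norm_eq_of_mem_sphere x)).symm 0 = -x := by
      rw [← stereographic_apply_neg]
      exact (stereographic _).left_inv hx
    rw [Set.image_compl_eq_range_sdiff_image h.injective, Set.image_singleton,
      range_stereographic_symm, h3]
    rfl

/-! ### Knot groups with Alexander polynomial one -/

section Alexander

variable {G : Type*} [Group G]

/-- Since `N` is its own commutator subgroup, containment of its image in one derived term passes to
the next. -/
theorem map_le_derivedSeries_of_perfect {H : Type*} [Group H] {N : Subgroup G} (hN : ⁅N, N⁆ = N)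
    (φ : G →* H) (n : ℕ) : N.map φ ≤ derivedSeries H n := by
  induction n with
  | zero => exact le_top
  | succ n ih =>
    rw [derivedSeries_succ, ← hN, Subgroup.map_commutator]
    exact Subgroup.commutator_mono ih ih

/-- A homomorphism to a residually solvable group kills every perfect subgroup. -/
theorem IsResiduallySolvable.map_eq_one {H : Type*} [Group H] (hH : IsResiduallySolvable H)
    {N : Subgroup G} (hN : ⁅N, N⁆ = N) (φ : G →* H) {g : G} (hg : g ∈ N) : φ g = 1 := by
  have h : φ g ∈ ⨅ n : ℕ, derivedSeries H n := Subgroup.mem_iInf.mpr fun n =>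
    map_le_derivedSeries_of_perfect hN φ n ⟨g, hg, rfl⟩
  rw [hH] at h
  exact h

/-- The abelianization of a normal subgroup, written additively. -/
abbrev AbModule (N : Subgroup G) : Type _ := Additive (Abelianization N)

/-- The action by conjugation of the group on the abelianization of a normal subgroup. -/
noncomputable def conjAction (N : Subgroup G) [N.Normal] : G →* Module.End ℤ (AbModule N) where
  toFun g := (MonoidHom.toAdditive (Abelianization.map (MulAut.conjNormal g).toMonoidHom)).toIntLinearMap
  map_one' := by
    ext x
    induction x using Additive.rec with | _ x
    induction x using QuotientGroup.induction_on with | _ x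
    change Additive.ofMul (Abelianization.of (MulAut.conjNormal (1 : G) x)) = _
    rw [map_one]
    rfl
  map_mul' g h := by
    ext x
    induction x using Additive.rec with | _ x
    induction x using QuotientGroup.induction_on with | _ x
    change Additive.ofMul (Abelianization.of (MulAut.conjNormal (g * h) x)) = _
    rw [map_mul]
    rfl

/-- The class in the abelianization of an element of the subgroup. -/
def abClass {N : Subgroup G} (g : G) (hg : g ∈ N) : AbModule N :=
  Additive.ofMul (Abelianization.of ⟨g, hg⟩)

theorem conjAction_abClass {N : Subgroup G} [N.Normal] (x g : G) (hg : g ∈ N) :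
    conjAction N x (abClass g hg) = abClass (x * g * x⁻¹) (Subgroup.Normal.conj_mem ‹_› g hg x) :=
  rfl

theorem abClass_mul {N : Subgroup G} {g h : G} (hg : g ∈ N) (hh : h ∈ N) :
    abClass (g * h) (N.mul_mem hg hh) = abClass g hg + abClass h hh := by
  unfold abClass
  rw [← ofMul_mul, ← map_mul]
  rfl

theorem abClass_eq_zero {N : Subgroup G} {g : G} (hg : g ∈ N) (h : g = 1) : abClass g hg = 0 := by
  subst h
  exact congrArg Additive.ofMul (map_one Abelianization.of)

theorem mem_commutator_of_abClass_eq_zero {N : Subgroup G} {g : G} (hg : g ∈ N)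
    (h : abClass g hg = 0) : g ∈ ⁅N, N⁆ := by
  have h1 : Abelianization.of (⟨g, hg⟩ : N) = 1 := h
  have h2 : (⟨g, hg⟩ : N) ∈ commutator N := (QuotientGroup.eq_one_iff _).mp h1
  rw [← Subgroup.map_subtype_commutator]
  exact ⟨_, h2, rfl⟩

/-- If a linear system over a commutative ring with invertible matrix acts on a module, then it has
only the trivial solution. -/
theorem eq_zero_of_isUnit_det {R M n : Type*} [CommRing R] [AddCommGroup M] [Fintype n]
    [DecidableEq n] (Θ : R →+* Module.End ℤ M) (A : Matrix n n R) (hA : IsUnit A.det) (y : n → M)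
    (h : ∀ i, ∑ l, Θ (A i l) (y l) = 0) (l : n) : y l = 0 := by
  have h1 : ∑ i, Θ (A⁻¹ l i) (∑ m, Θ (A i m) (y m)) = y l := by
    simp_rw [map_sum]
    rw [Finset.sum_comm]
    have h2 : ∀ m, ∑ i, Θ (A⁻¹ l i) (Θ (A i m) (y m)) = Θ ((1 : Matrix n n R) l m) (y m) := by
      intro m
      rw [← Matrix.nonsing_inv_mul A hA, Matrix.mul_apply, map_sum, LinearMap.sum_apply]
      refine Finset.sum_congr rfl fun i _ => ?_
      rw [map_mul]
      rfl
    simp_rw [h2]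
    rw [Finset.sum_eq_single l]
    · simp
    · intro m _ hm
      rw [Matrix.one_apply_ne hm.symm, map_zero]
      rfl
    · simp
  rw [← h1]
  simp [h]

/-- The commutator subgroup of a group with Alexander polynomial one is perfect. -/
theorem commutator_perfect_of_hasAlexanderPolynomial (h : HasAlexanderPolynomial G 1) :
    ⁅commutator G, commutator G⁆ = commutator G := by
  obtain ⟨k, r, e, a, j, hker, ha, hdet⟩ := h
  refine le_antisymm (Subgroup.commutator_le_self _) fun g hg => ?_
  have hdet' := (associated_one_iff_isUnit.mp hdet.symm)
  let N := commutator G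
  let π : FreeGroup (Fin (k + 1)) →* G := e.toMonoidHom.comp (PresentedGroup.mk _)
  have hπ : Function.Surjective π := e.surjective.comp (PresentedGroup.mk_surjective _)
  have hπr : ∀ i, π (r i) = 1 := by
    intro i
    have : PresentedGroup.mk (Set.range r) (r i) = 1 := PresentedGroup.one_of_mem ⟨i, rfl⟩
    change e (PresentedGroup.mk (Set.range r) (r i)) = 1
    rw [this, map_one]
  let x : G := π (FreeGroup.of j)
  have hx : a x = Multiplicative.ofAdd 1 := ha j
  -- The Alexander module structure on the abelianized commutator subgroup: `t` acts as conjugation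
  -- by the lift `x`.
  let C : Multiplicative ℤ →* Module.End ℤ (AbModule N) :=
    (conjAction N).comp (zpowersHom G x)
  let Θ : ℤ[T;T⁻¹] →ₐ[ℤ] Module.End ℤ (AbModule N) := AddMonoidAlgebra.lift ℤ _ _ C
  have hΘ : ∀ w : FreeGroup (Fin (k + 1)),
      Θ (groupRingToLaurent _ (MonoidAlgebra.of ℤ _ w)) = C (a (π w)) := by
    intro w
    have : ((Θ : ℤ[T;T⁻¹] →* _).comp ((groupRingToLaurent (Fin (k + 1)) :
        MonoidAlgebra ℤ (FreeGroup (Fin (k + 1))) →* ℤ[T;T⁻¹]).comp (MonoidAlgebra.of ℤ _))) =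
        C.comp (a.comp π) := by
      refine FreeGroup.ext_hom _ _ fun l => ?_
      have h1 : a (π (FreeGroup.of l)) = Multiplicative.ofAdd 1 := ha l
      change Θ (groupRingToLaurent _ (MonoidAlgebra.of ℤ _ (FreeGroup.of l))) = C (a (π _))
      rw [h1]
      have h2 : groupRingToLaurent _ (MonoidAlgebra.of ℤ _ (FreeGroup.of l)) =
          LaurentPolynomial.T 1 := by
        simp [groupRingToLaurent, freeToLaurent]
      rw [h2]
      exact (AddMonoidAlgebra.lift_single C 1 1).trans (one_smul _ _)
    exact DFunLike.congr_fun this w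
  have hmem : ∀ w, π w * x ^ (-(a (π w)).toAdd) ∈ N := by
    intro w
    change _ ∈ commutator G
    rw [← hker, MonoidHom.mem_ker, map_mul, map_zpow, hx, ← ofAdd_zsmul]
    simp
  -- Dividing by the matching power of `x` moves every word into `N`. The result is a crossed
  -- homomorphism, since `π u * π v` regroups with `π v` conjugated by the power of `x` belonging to
  -- `u`.
  let D : FreeGroup (Fin (k + 1)) → AbModule N := fun w => abClass _ (hmem w)
  have hDmul : ∀ u v, D (u * v) = D u + C (a (π u)) (D v) := by
    intro u v
    change abClass _ _ = abClass _ _ + conjAction N (x ^ (a (π u)).toAdd) (abClass _ _)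
    rw [conjAction_abClass, ← abClass_mul]
    congr 1
    simp only [map_mul, toAdd_mul, neg_add, zpow_add, zpow_neg]
    group
  let S : FreeGroup (Fin (k + 1)) → AbModule N := fun w =>
    ∑ l, Θ (groupRingToLaurent _ (foxDeriv l w)) (D (FreeGroup.of l))
  have hSmul : ∀ u v, S (u * v) = S u + C (a (π u)) (S v) := by
    intro u v
    simp only [S]
    rw [map_sum, ← Finset.sum_add_distrib]
    refine Finset.sum_congr rfl fun l _ => ?_
    rw [foxDeriv_mul, map_add, map_add, map_mul, map_mul, hΘ]
    rfl
  have hC : ∀ u y, C (a (π u)) y = 0 → y = 0 := by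
    intro u y hy
    have : C (a (π u⁻¹)) (C (a (π u)) y) = y := by
      rw [← Module.End.mul_apply, ← map_mul, ← map_mul, ← map_mul, inv_mul_cancel, map_one, map_one,
        map_one]
      rfl
    rw [← this, hy, map_zero]
  have hone : ∀ E : FreeGroup (Fin (k + 1)) → AbModule N,
      (∀ u v, E (u * v) = E u + C (a (π u)) (E v)) → E 1 = 0 := by
    intro E hE
    have := hE 1 1
    rw [map_one, map_one, map_one, mul_one] at this
    exact left_eq_add.mp this
  -- The fundamental formula of Fox calculus: two crossed homomorphisms that agree on the generators
  -- are equal.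
  have hDS : ∀ w, D w = S w := by
    intro w
    induction w using FreeGroup.induction_on with
    | C1 => rw [hone D hDmul, hone S hSmul]
    | of l =>
      simp only [S, foxDeriv_of]
      rw [Finset.sum_eq_single l]
      · simp
      · intro m _ hm
        rw [if_neg hm.symm, map_zero, map_zero]
        rfl
      · simp
    | inv_of l ih =>
      have h1 := hDmul (FreeGroup.of l) (FreeGroup.of l)⁻¹
      have h2 := hSmul (FreeGroup.of l) (FreeGroup.of l)⁻¹
      rw [mul_inv_cancel, hone D hDmul] at h1
      rw [mul_inv_cancel, hone S hSmul, ← ih, h1] at h2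
      have h3 := hC (FreeGroup.of l) (D (FreeGroup.of l)⁻¹ - S (FreeGroup.of l)⁻¹) (by
        rw [map_sub, add_left_cancel h2, sub_self])
      exact sub_eq_zero.mp h3
    | mul u v hu hv => rw [hDmul, hSmul, hu, hv]
  have hDj : D (FreeGroup.of j) = 0 := by
    refine abClass_eq_zero _ ?_
    change x * x ^ (-(a x).toAdd) = 1
    rw [hx]
    simp
  -- The choice of `x` as the image of generator `j` removes column `j`. The relators then give a
  -- square homogeneous system for the other generators, and its determinant is a unit.
  have hy : ∀ l, D (FreeGroup.of (j.succAbove l)) = 0 := by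
    refine eq_zero_of_isUnit_det (Θ : ℤ[T;T⁻¹] →+* _) _ hdet'
      (fun l => D (FreeGroup.of (j.succAbove l))) fun i => ?_
    have h1 : D (r i) = 0 := abClass_eq_zero _ (by simp [hπr])
    rw [hDS] at h1
    simp only [S] at h1
    rw [Fin.sum_univ_succAbove _ j, hDj, map_zero, zero_add] at h1
    exact h1
  have hD0 : ∀ w, D w = 0 := by
    intro w
    rw [hDS]
    refine Finset.sum_eq_zero fun l _ => ?_
    rcases Fin.eq_self_or_eq_succAbove j l with rfl | ⟨l, rfl⟩
    · rw [hDj, map_zero]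
    · rw [hy, map_zero]
  obtain ⟨w, rfl⟩ := hπ g
  have hw : a (π w) = 1 := by rwa [← MonoidHom.mem_ker, hker]
  have h1 := mem_commutator_of_abClass_eq_zero _ (hD0 w)
  rwa [hw, toAdd_one, neg_zero, zpow_zero, mul_one] at h1

end Alexander

/-! ### Tubes and their exteriors -/

section Polar

/-- The radial projection of a nonzero complex number to the circle. -/
noncomputable def circleDirection (w : ℂ) (hw : w ≠ 0) : Circle :=
  ⟨w / (‖w‖ : ℂ), mem_sphere_zero_iff_norm.mpr (by
    rw [norm_div, Complex.norm_real, norm_norm, div_self (norm_ne_zero_iff.mpr hw)])⟩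

theorem coe_circleDirection (w : ℂ) (hw : w ≠ 0) :
    (circleDirection w hw : ℂ) = w / (‖w‖ : ℂ) := rfl

theorem circleDirection_real_mul (r : ℝ) (hr : 0 < r) (w : Circle) (h : (r : ℂ) * w ≠ 0) :
    circleDirection ((r : ℂ) * w) h = w := by
  apply Circle.ext
  rw [coe_circleDirection, norm_mul, Circle.norm_coe, Complex.norm_real, mul_one,
    Real.norm_of_nonneg hr.le]
  exact mul_div_cancel_left₀ _ (Complex.ofReal_ne_zero.mpr hr.ne')

theorem norm_real_mul (r : ℝ) (hr : 0 < r) (w : Circle) : ‖(r : ℂ) * w‖ = r := by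
  rw [norm_mul, Circle.norm_coe, Complex.norm_real, mul_one, Real.norm_of_nonneg hr.le]

theorem real_mul_circleDirection (w : ℂ) (hw : w ≠ 0) :
    ((‖w‖ : ℝ) : ℂ) * circleDirection w hw = w := by
  rw [coe_circleDirection]
  exact mul_div_cancel₀ _ (Complex.ofReal_ne_zero.mpr (norm_ne_zero_iff.mpr hw))

/-- Direction and norm give a continuous left inverse away from the core. The radial profile `f` is
left free so that the same argument covers the inside and the outside of the unit circle. -/
theorem isEmbedding_polar {f : NNReal → ℝ} {g : ℝ → NNReal} (hf : Continuous f)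
    (hpos : ∀ u, 0 < f u) (hg : ContinuousOn g (Set.Ioi 0)) (hgf : ∀ u, g (f u) = u) :
    IsEmbedding fun v : (Circle × Circle) × NNReal => (v.1.1, ((f v.2 : ℝ) : ℂ) * (v.1.2 : ℂ)) := by
  let i : {p : Circle × ℂ // p.2 ≠ 0} → (Circle × Circle) × NNReal :=
    fun p => ((p.1.1, circleDirection p.1.2 p.2), g ‖p.1.2‖)
  have hne : ∀ v : (Circle × Circle) × NNReal, ((f v.2 : ℝ) : ℂ) * (v.1.2 : ℂ) ≠ 0 := fun v =>
    mul_ne_zero (Complex.ofReal_ne_zero.mpr (hpos _).ne') (Circle.coe_ne_zero _)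
  let j : (Circle × Circle) × NNReal → {p : Circle × ℂ // p.2 ≠ 0} := fun v =>
    ⟨(v.1.1, ((f v.2 : ℝ) : ℂ) * (v.1.2 : ℂ)), hne v⟩
  have hj : Continuous fun v : (Circle × Circle) × NNReal =>
      (v.1.1, ((f v.2 : ℝ) : ℂ) * (v.1.2 : ℂ)) := by fun_prop
  have hi : Continuous i := by
    refine Continuous.prodMk (Continuous.prodMk (by fun_prop) ?_) ?_
    · refine Continuous.subtype_mk ?_ _
      refine Continuous.div (by fun_prop) (by fun_prop) fun p => ?_
      exact Complex.ofReal_ne_zero.mpr (norm_ne_zero_iff.mpr p.2)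
    · exact hg.comp_continuous (by fun_prop) fun p => norm_pos_iff.mpr p.2
  have hl : Function.LeftInverse i j := by
    rintro ⟨⟨z, w⟩, u⟩
    simp only [i, j]
    rw [circleDirection_real_mul _ (hpos u), norm_real_mul _ (hpos u), hgf]
  exact IsEmbedding.subtypeVal.comp (IsEmbedding.of_leftInverse hl hi (hj.subtype_mk _))

/-- Polar coordinates on the punctured closed disk. -/
noncomputable def polarIn : C((Circle × Circle) × NNReal, Circle × ℂ) :=
  ⟨fun v => (v.1.1, (((1 + (v.2 : ℝ))⁻¹ : ℝ) : ℂ) * (v.1.2 : ℂ)), by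
    have : ∀ v : (Circle × Circle) × NNReal, 1 + (v.2 : ℝ) ≠ 0 := fun v => by positivity
    fun_prop (disch := assumption)⟩

/-- Polar coordinates on the complement of the open disk. -/
noncomputable def polarOut : C((Circle × Circle) × NNReal, Circle × ℂ) :=
  ⟨fun v => (v.1.1, ((1 + (v.2 : ℝ) : ℝ) : ℂ) * (v.1.2 : ℂ)), by fun_prop⟩

theorem isEmbedding_polarIn : IsEmbedding polarIn := by
  refine isEmbedding_polar (f := fun u => (1 + (u : ℝ))⁻¹)
    (g := fun r => Real.toNNReal (r⁻¹ - 1)) ?_ (fun u => by positivity) ?_ ?_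
  · exact Continuous.inv₀ (by fun_prop) fun u => by positivity
  · refine continuous_real_toNNReal.comp_continuousOn ?_
    exact (continuousOn_inv₀.mono fun r hr => ne_of_gt hr).sub continuousOn_const
  · intro u; simp

theorem isEmbedding_polarOut : IsEmbedding polarOut := by
  refine isEmbedding_polar (f := fun u => 1 + (u : ℝ))
    (g := fun r => Real.toNNReal (r - 1)) (by fun_prop) (fun u => by positivity) ?_ ?_
  · exact (continuous_real_toNNReal.comp (by fun_prop)).continuousOn
  · intro u; simp

theorem range_polarIn : Set.range polarIn = {p | p.2 ≠ 0 ∧ ‖p.2‖ ≤ 1} := by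
  refine Set.Subset.antisymm ?_ ?_
  · rintro _ ⟨⟨⟨z, w⟩, u⟩, rfl⟩
    have h : 0 < (1 + (u : ℝ))⁻¹ := by positivity
    refine ⟨mul_ne_zero (Complex.ofReal_ne_zero.mpr h.ne') (Circle.coe_ne_zero _), ?_⟩
    exact (norm_real_mul _ h w).trans_le (inv_le_one_of_one_le₀ (by simp))
  · rintro ⟨z, w⟩ ⟨hw, hw1⟩
    have hpos : 0 < ‖w‖ := norm_pos_iff.mpr hw
    refine ⟨((z, circleDirection w hw), Real.toNNReal (‖w‖⁻¹ - 1)), ?_⟩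
    refine Prod.ext rfl ?_
    change (((1 + ((Real.toNNReal (‖w‖⁻¹ - 1) : NNReal) : ℝ))⁻¹ : ℝ) : ℂ) * _ = w
    have : 1 ≤ ‖w‖⁻¹ := (one_le_inv₀ hpos).mpr hw1
    rw [Real.coe_toNNReal _ (by linarith), add_sub_cancel, inv_inv, real_mul_circleDirection]

theorem range_polarOut : Set.range polarOut = {p | 1 ≤ ‖p.2‖} := by
  refine Set.Subset.antisymm ?_ ?_
  · rintro _ ⟨⟨⟨z, w⟩, u⟩, rfl⟩
    have h : 0 < 1 + (u : ℝ) := by positivity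
    exact (le_add_of_nonneg_right u.2).trans_eq (norm_real_mul _ h w).symm
  · rintro ⟨z, w⟩ (hw1 : 1 ≤ ‖w‖)
    have hw : w ≠ 0 := norm_pos_iff.mp (by linarith)
    refine ⟨((z, circleDirection w hw), Real.toNNReal (‖w‖ - 1)), ?_⟩
    refine Prod.ext rfl ?_
    change ((1 + ((Real.toNNReal (‖w‖ - 1) : NNReal) : ℝ) : ℝ) : ℂ) * _ = w
    rw [Real.coe_toNNReal _ (by linarith), add_sub_cancel, real_mul_circleDirection]

theorem polarIn_mem (v : (Circle × Circle) × NNReal) :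
    (polarIn v).2 ≠ 0 ∧ ‖(polarIn v).2‖ ≤ 1 := by
  have h : polarIn v ∈ Set.range polarIn := ⟨v, rfl⟩
  rwa [range_polarIn] at h

theorem polarIn_mem_closedBall (v : (Circle × Circle) × NNReal) :
    (polarIn v).2 ∈ Metric.closedBall (0 : ℂ) 1 :=
  mem_closedBall_zero_iff.mpr (polarIn_mem v).2

theorem norm_closedBall_le (w : Metric.closedBall (0 : ℂ) 1) : ‖(w : ℂ)‖ ≤ 1 := by
  have := w.2
  rwa [mem_closedBall_zero_iff] at this

end Polar

section Tube

variable {ν : Circle × ℂ → S3} (hν : IsOpenEmbedding ν) {W P Q : S3 → Prop}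

theorem mem_exterior_tube_iff (hν : IsOpenEmbedding ν) (p : Circle × ℂ) :
    ν p ∈ exterior ν ↔ 1 ≤ ‖p.2‖ := by
  constructor
  · intro h
    by_contra hp
    exact h ⟨p, not_le.mp hp, rfl⟩
  · rintro h ⟨q, hq, hqp⟩
    rw [hν.injective hqp] at hq
    exact absurd (show ‖p.2‖ < 1 from hq) (not_lt.mpr h)

theorem isClosed_exterior (hν : IsOpenEmbedding ν) : IsClosed (exterior ν) :=
  (hν.isOpenMap _ (isOpen_lt (by fun_prop) (by fun_prop))).isClosed_compl

/-- Filling in a tube: a set is the union of the part exterior to the tube and of the tube. -/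
noncomputable def fillDecomposition (hW : ∀ p, ‖p.2‖ ≤ 1 → W (ν p))
    (hP : ∀ x, P x ↔ x ∈ exterior ν ∧ W x) :
    CollaredPushout {x // W x} {x // P x} (Circle × Metric.closedBall (0 : ℂ) 1)
      (Circle × Circle) where
  iA := ⟨fun x => ⟨x.1, ((hP _).mp x.2).2⟩, continuous_subtype_val.subtype_mk _⟩
  iB := ⟨fun p => ⟨ν (p.1, p.2), hW (p.1, p.2) (norm_closedBall_le p.2)⟩,
    (hν.continuous.comp (by fun_prop)).subtype_mk _⟩
  τA := ⟨fun t => ⟨ν (t.1, t.2), (hP _).mpr ⟨(mem_exterior_tube_iff hν _).mpr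
      (Circle.norm_coe _).ge, hW _ (Circle.norm_coe _).le⟩⟩,
    (hν.continuous.comp (by fun_prop)).subtype_mk _⟩
  τB := ⟨fun t => (t.1, ⟨t.2, by simp [Circle.norm_coe]⟩), by fun_prop⟩
  -- The solid torus without its core: radius $1/(1+u)$ sweeps $(0,1]$, so the collar is open and
  -- misses only the core.
  collar := ⟨fun v => ((polarIn v).1, ⟨(polarIn v).2, polarIn_mem_closedBall v⟩),
    (continuous_fst.comp polarIn.continuous).prodMk
      ((continuous_snd.comp polarIn.continuous).subtype_mk polarIn_mem_closedBall)⟩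
  isClosedEmbedding_iA := by
    refine ⟨IsEmbedding.of_comp (by fun_prop) continuous_subtype_val ?_, ?_⟩
    · exact IsEmbedding.subtypeVal
    · convert (isClosed_exterior hν).preimage (continuous_subtype_val (p := W)) using 1
      ext ⟨x, hx⟩
      constructor
      · rintro ⟨y, hy⟩
        rw [← hy]
        exact ((hP _).mp y.2).1
      · intro h
        exact ⟨⟨x, (hP _).mpr ⟨h, hx⟩⟩, rfl⟩
  isClosedEmbedding_iB := by
    refine Continuous.isClosedEmbedding (ContinuousMap.continuous _) ?_
    rintro ⟨z, w⟩ ⟨z', w'⟩ h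
    have h1 : (z, (w : ℂ)) = (z', (w' : ℂ)) := hν.injective (congrArg Subtype.val h)
    obtain ⟨h2, h3⟩ := Prod.mk.inj h1
    exact Prod.ext h2 (Subtype.ext h3)
  cover := by
    rintro ⟨x, hx⟩
    by_cases h : x ∈ exterior ν
    · exact Or.inl ⟨⟨x, (hP _).mpr ⟨h, hx⟩⟩, rfl⟩
    · obtain ⟨⟨z, w⟩, hp, rfl⟩ := not_not.mp h
      exact Or.inr ⟨(z, ⟨w, by simpa using le_of_lt (show ‖w‖ < 1 from hp)⟩), rfl⟩
  comm t := rfl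
  glue := by
    rintro ⟨a, ha⟩ ⟨z, w, hw⟩ h
    obtain rfl : a = ν (z, w) := congrArg Subtype.val h
    have h1 : 1 ≤ ‖w‖ := (mem_exterior_tube_iff hν _).mp ((hP _).mp ha).1
    have h2 : ‖w‖ = 1 := le_antisymm (by simpa using hw) h1
    exact ⟨(z, ⟨w, mem_sphere_zero_iff_norm.mpr h2⟩), rfl, rfl⟩
  isOpenEmbedding_collar := by
    have hc : Continuous fun p : Circle × Metric.closedBall (0 : ℂ) 1 => (p.1, (p.2 : ℂ)) := by
      fun_prop
    refine ⟨IsEmbedding.of_comp (ContinuousMap.continuous _) hc isEmbedding_polarIn, ?_⟩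
    convert (isOpen_ne (x := (0 : ℂ))).preimage (hc.snd) using 1
    ext ⟨z, w, hw⟩
    constructor
    · rintro ⟨v, hv⟩
      have h1 := polarIn_mem v
      have h2 : (polarIn v).2 = w :=
        congrArg (fun p : Circle × Metric.closedBall (0 : ℂ) 1 => (p.2 : ℂ)) hv
      change w ≠ 0
      rw [← h2]
      exact h1.1
    · intro h
      have h1 : (z, w) ∈ Set.range polarIn := by
        rw [range_polarIn]
        exact ⟨h, by simpa using hw⟩
      obtain ⟨v, hv⟩ := h1
      have h2 : (polarIn v).1 = z := by rw [hv]
      have h3 : (polarIn v).2 = w := by rw [hv]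
      exact ⟨v, Prod.ext h2 (Subtype.ext h3)⟩
  collar_zero := by
    rintro ⟨z, w⟩
    refine Prod.ext rfl (Subtype.ext ?_)
    simp [polarIn]

/-- The complement of the core of a tube is the union of the part exterior to the tube and of the
punctured tube. -/
noncomputable def punctureDecomposition (hW : ∀ p, ‖p.2‖ ≤ 1 → W (ν p))
    (hP : ∀ x, P x ↔ x ∈ exterior ν ∧ W x) (hQ : ∀ x, Q x ↔ W x ∧ ∀ z, ν (z, 0) ≠ x) :
    CollaredPushout {x // Q x} {x // P x} ((Circle × Circle) × NNReal) (Circle × Circle) where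
  iA := ⟨fun x => ⟨x.1, (hQ _).mpr ⟨((hP _).mp x.2).2, by
      rintro z hz
      have h := ((hP _).mp x.2).1
      rw [← hz, mem_exterior_tube_iff hν, norm_zero] at h
      linarith⟩⟩, continuous_subtype_val.subtype_mk _⟩
  iB := ⟨fun v => ⟨ν (polarIn v), (hQ _).mpr ⟨hW _ (polarIn_mem v).2, fun _ hz =>
        (polarIn_mem v).1 (congrArg Prod.snd (hν.injective hz)).symm⟩⟩,
    (hν.continuous.comp polarIn.continuous).subtype_mk _⟩
  τA := ⟨fun t => ⟨ν (t.1, t.2), (hP _).mpr ⟨(mem_exterior_tube_iff hν _).mpr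
      (Circle.norm_coe _).ge, hW _ (Circle.norm_coe _).le⟩⟩,
    (hν.continuous.comp (by fun_prop)).subtype_mk _⟩
  τB := ⟨fun t => (t, 0), by fun_prop⟩
  collar := ContinuousMap.id _
  isClosedEmbedding_iA := by
    refine ⟨IsEmbedding.of_comp (by fun_prop) continuous_subtype_val ?_, ?_⟩
    · exact IsEmbedding.subtypeVal
    · convert (isClosed_exterior hν).preimage (continuous_subtype_val (p := Q)) using 1
      ext ⟨x, hx⟩
      constructor
      · rintro ⟨y, hy⟩
        rw [← hy]
        exact ((hP _).mp y.2).1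
      · intro h
        exact ⟨⟨x, (hP _).mpr ⟨h, ((hQ _).mp hx).1⟩⟩, rfl⟩
  isClosedEmbedding_iB := by
    refine ⟨IsEmbedding.of_comp (ContinuousMap.continuous _) continuous_subtype_val ?_, ?_⟩
    · exact hν.isEmbedding.comp isEmbedding_polarIn
    · have hcl : IsClosed (ν '' {p | ‖p.2‖ ≤ 1}) := by
        have : {p : Circle × ℂ | ‖p.2‖ ≤ 1} = Set.univ ×ˢ Metric.closedBall (0 : ℂ) 1 := by
          ext p; simp
        rw [this]
        exact ((isCompact_univ.prod (isCompact_closedBall _ _)).image hν.continuous).isClosed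
      convert hcl.preimage (continuous_subtype_val (p := Q)) using 1
      ext ⟨x, hx⟩
      constructor
      · rintro ⟨v, hv⟩
        exact ⟨polarIn v, (polarIn_mem v).2, congrArg Subtype.val hv⟩
      · rintro ⟨⟨z, w⟩, hp, rfl⟩
        have : (z, w) ∈ Set.range polarIn := by
          rw [range_polarIn]
          refine ⟨?_, hp⟩
          rintro (rfl : w = 0)
          exact ((hQ _).mp hx).2 z rfl
        obtain ⟨v, hv⟩ := this
        exact ⟨v, Subtype.ext (congrArg ν hv)⟩
  cover := by
    rintro ⟨x, hx⟩
    by_cases h : x ∈ exterior ν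
    · exact Or.inl ⟨⟨x, (hP _).mpr ⟨h, ((hQ _).mp hx).1⟩⟩, rfl⟩
    · obtain ⟨⟨z, w⟩, hp, rfl⟩ := not_not.mp h
      have : (z, w) ∈ Set.range polarIn := by
        rw [range_polarIn]
        refine ⟨?_, le_of_lt hp⟩
        rintro (rfl : w = 0)
        exact ((hQ _).mp hx).2 z rfl
      obtain ⟨v, hv⟩ := this
      exact Or.inr ⟨v, Subtype.ext (congrArg ν hv)⟩
  comm t := by
    apply Subtype.ext
    simp [polarIn]
  glue := by
    rintro ⟨a, ha⟩ v h
    obtain rfl : a = ν (polarIn v) := congrArg Subtype.val h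
    have h1 : 1 ≤ ‖(polarIn v).2‖ := (mem_exterior_tube_iff hν _).mp ((hP _).mp ha).1
    have h2 : ‖(polarIn v).2‖ = (1 + (v.2 : ℝ))⁻¹ := norm_real_mul _ (by positivity) v.1.2
    have h3 : v.2 = 0 := by
      rw [h2, one_le_inv₀ (by positivity)] at h1
      exact le_antisymm (show (v.2 : ℝ) ≤ 0 by linarith) v.2.2
    obtain ⟨t, u⟩ := v
    obtain rfl : u = 0 := h3
    exact ⟨t, Subtype.ext (by simp [polarIn]), rfl⟩
  isOpenEmbedding_collar := IsOpenEmbedding.id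
  collar_zero t := rfl

/-! ### Connectedness of complements -/

/-- In a separation of `W \ C` the connected set `O \ C` lies on one side. Adding all of `O` to that
side, which puts `C` back, would separate `W`. Connectedness upgrades to path connectedness because
the set is open in a manifold. -/
theorem isPathConnected_sdiff {W O C : Set S3} (hW : IsOpen W) (hWc : IsPathConnected W)
    (hO : IsOpen O) (hC : IsClosed C) (hCO : C ⊆ O) (hOW : O ⊆ W) (hOC : IsConnected (O \ C)) :
    IsPathConnected (W \ C) := by
  have : LocallyPathConnectedSpace S3 :=
    ChartedSpace.locallyPathConnectedSpace (EuclideanSpace ℝ (Fin 3)) S3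
  rw [← (hW.sdiff hC).isConnected_iff_isPathConnected]
  refine ⟨hOC.nonempty.mono (Set.sdiff_subset_sdiff_left hOW), ?_⟩
  rw [isPreconnected_iff_subset_of_disjoint]
  have key : ∀ u v : Set S3, IsOpen u → IsOpen v → W \ C ⊆ u ∪ v → W \ C ∩ (u ∩ v) = ∅ →
      O \ C ⊆ u → W \ C ⊆ u ∨ W \ C ⊆ v := by
    intro u v hu hv huv hd hOu
    have h1 := isPreconnected_iff_subset_of_disjoint.mp hWc.isConnected.isPreconnected (u ∪ O)
      (v \ C) (hu.union hO) (hv.sdiff hC) ?_ ?_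
    · rcases h1 with h1 | h1
      · left
        rintro x ⟨hxW, hxC⟩
        rcases h1 hxW with h | h
        exacts [h, hOu ⟨h, hxC⟩]
      · right
        exact fun x hx => (h1 hx.1).1
    · intro x hx
      by_cases hxC : x ∈ C
      · exact Or.inl (Or.inr (hCO hxC))
      · rcases huv ⟨hx, hxC⟩ with h | h
        exacts [Or.inl (Or.inl h), Or.inr ⟨h, hxC⟩]
    · rw [Set.eq_empty_iff_forall_notMem] at hd ⊢
      rintro x ⟨hxW, hxu, hxv, hxC⟩
      rcases hxu with h | h
      · exact hd x ⟨⟨hxW, hxC⟩, h, hxv⟩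
      · exact hd x ⟨⟨hxW, hxC⟩, hOu ⟨h, hxC⟩, hxv⟩
  intro u v hu hv huv hd
  have hsub : O \ C ⊆ W \ C := Set.sdiff_subset_sdiff_left hOW
  rcases isPreconnected_iff_subset_of_disjoint.mp hOC.isPreconnected u v hu hv
    (hsub.trans huv) (Set.subset_empty_iff.mp (hd ▸ Set.inter_subset_inter_left _ hsub)) with h | h
  · exact key u v hu hv huv hd h
  · exact (key v u hv hu (by rwa [Set.union_comm]) (by rwa [Set.inter_comm v]) h).symm

/-- The complement of the core of a tube in a path connected open set is path connected. -/
theorem isPathConnected_compl_core (hν : IsOpenEmbedding ν) {W : Set S3} (hWo : IsOpen W)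
    (hWc : IsPathConnected W) (hW : ∀ p : Circle × ℂ, ‖p.2‖ ≤ 1 → ν p ∈ W) :
    IsPathConnected (W \ Set.range fun z => ν (z, 0)) := by
  have hcl : IsClosed (Set.range fun z => ν (z, 0)) :=
    (isCompact_range (hν.continuous.comp (by fun_prop))).isClosed
  refine isPathConnected_sdiff (O := ν '' {p | ‖p.2‖ < 1}) hWo hWc
    (hν.isOpenMap _ (isOpen_lt (by fun_prop) (by fun_prop))) hcl ?_ ?_ ?_
  · rintro _ ⟨z, rfl⟩
    exact ⟨(z, 0), by simp, rfl⟩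
  · rintro _ ⟨p, hp, rfl⟩
    exact hW p (le_of_lt hp)
  · have h1 : IsConnected ((Set.univ : Set (Circle × Circle)) ×ˢ Set.Ioo (0 : ℝ) 1) :=
      isConnected_univ.prod (isConnected_Ioo zero_lt_one)
    have h2 : Continuous fun v : (Circle × Circle) × ℝ => ν (v.1.1, (v.2 : ℂ) * (v.1.2 : ℂ)) :=
      hν.continuous.comp (by fun_prop)
    convert h1.image _ h2.continuousOn using 1
    ext x
    constructor
    · rintro ⟨⟨⟨z, w⟩, hp, rfl⟩, hx⟩
      have hw : w ≠ 0 := by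
        rintro rfl
        exact hx ⟨z, rfl⟩
      refine ⟨((z, circleDirection w hw), ‖w‖), ⟨trivial, norm_pos_iff.mpr hw, hp⟩, ?_⟩
      exact congrArg (fun w => ν (z, w)) (real_mul_circleDirection w hw)
    · rintro ⟨⟨⟨z, w⟩, r⟩, ⟨-, hr0, hr1⟩, rfl⟩
      refine ⟨⟨_, ?_, rfl⟩, ?_⟩
      · exact (norm_real_mul r hr0 w).trans_lt hr1
      · rintro ⟨z', hz'⟩
        have h3 := congrArg Prod.snd (hν.injective hz')
        exact mul_ne_zero (Complex.ofReal_ne_zero.mpr (ne_of_gt hr0)) (Circle.coe_ne_zero w) h3.symm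

/-- When the collar is all of `B`, the retraction is defined on the whole of `X` and maps it onto
`A`. -/
theorem CollaredPushout.pathConnectedSpace {X A B T : Type*} [TopologicalSpace X]
    [TopologicalSpace A] [TopologicalSpace B] [TopologicalSpace T] (D : CollaredPushout X A B T)
    (hD : Function.Surjective D.collar) [PathConnectedSpace X] : PathConnectedSpace A := by
  obtain ⟨r, hr, -⟩ := D.exists_retraction
  have hU : ∀ x, x ∈ D.U := by
    intro x
    rcases D.cover x with ⟨a, rfl⟩ | ⟨b, rfl⟩
    exacts [D.iA_mem_U a, (D.iB_mem_U_iff b).mpr (hD b)]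
  let f : X → A := fun x => r ⟨x, hU x⟩
  have hf : Continuous f := r.continuous.comp (continuous_id.subtype_mk _)
  have hfs : Function.Surjective f := fun a => ⟨D.iA a, hr a⟩
  exact hfs.pathConnectedSpace hf

/-- The exterior of a tube in a path connected open set is path connected. -/
theorem pathConnectedSpace_exterior (hν : IsOpenEmbedding ν) (hWo : IsOpen {x | W x})
    (hWc : IsPathConnected {x | W x}) (hW : ∀ p, ‖p.2‖ ≤ 1 → W (ν p))
    (hP : ∀ x, P x ↔ x ∈ exterior ν ∧ W x) : PathConnectedSpace {x // P x} := by
  have hc := isPathConnected_compl_core hν hWo hWc hW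
  have : PathConnectedSpace {x : S3 // W x ∧ ∀ z, ν (z, 0) ≠ x} := by
    have h1 := isPathConnected_iff_pathConnectedSpace.mp hc
    have h2 : ({x | W x} \ Set.range fun z => ν (z, 0)) = {x | W x ∧ ∀ z, ν (z, 0) ≠ x} := by
      ext x; simp
    rw [h2] at h1
    exact h1
  exact (punctureDecomposition hν hW hP (fun _ => Iff.rfl)).pathConnectedSpace
    Function.surjective_id

theorem isPathConnected_univ_sphere : IsPathConnected (Set.univ : Set S3) := by
  have h : IsPathConnected (Metric.sphere (0 : EuclideanSpace ℝ (Fin 4)) 1) := by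
    refine isPathConnected_sphere ?_ 0 zero_le_one
    rw [← Module.finrank_eq_rank]
    simp
  have := isPathConnected_iff_pathConnectedSpace.mp h
  exact isPathConnected_univ

theorem KnotTheory.Knot.isPathConnected_compl (K : Knot) : IsPathConnected {x | x ∉ K.carrier} := by
  obtain ⟨ν, hν⟩ := K.tame
  convert isPathConnected_compl_core hν.isOpenEmbedding isOpen_univ isPathConnected_univ_sphere
    (fun _ _ => trivial) using 1
  ext x
  simp [Knot.carrier, hν.core]

theorem KnotTheory.Knot.isClosed_carrier (K : Knot) : IsClosed K.carrier := by
  obtain ⟨ν, hν⟩ := K.tame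
  have : K.curve = fun z => ν (z, 0) := funext fun z => (hν.core z).symm
  have hc : Continuous K.curve := by
    rw [this]
    exact hν.isOpenEmbedding.continuous.comp (by fun_prop)
  exact (isCompact_range hc).isClosed

instance (K : Knot) : PathConnectedSpace K.Complement :=
  isPathConnected_iff_pathConnectedSpace.mp K.isPathConnected_compl

end Tube

/-! ### Van Kampen's theorem in terms of loops at one point -/

namespace PathCocycle

variable {X Y H : Type*} [TopologicalSpace X] [TopologicalSpace Y] [Group H]

theorem comap_gauge (c : PathCocycle X H) (g : X → H) (f : C(Y, X)) :
    (c.gauge g).comap f = (c.comap f).gauge (g ∘ f) := rfl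

/-- If the restrictions of two cocycles to an injectively mapped path connected space agree on the
loops at one point, then a gauge transformation makes these restrictions equal. -/
theorem exists_gauge_comap_eq [PathConnectedSpace Y] (c c' : PathCocycle X H) (f : C(Y, X))
    (hf : Function.Injective f) (y : Y) (h : ∀ p : Path y y, c.comap f p = c'.comap f p) :
    ∃ g : X → H, g (f y) = 1 ∧ (c.gauge g).comap f = c'.comap f := by
  obtain ⟨g, hg1, hg⟩ := exists_gauge (c.comap f) (c'.comap f) y h
  refine ⟨Function.extend f g 1, by rw [hf.extend_apply, hg1], ?_⟩
  rw [hg, comap_gauge, Function.extend_comp hf]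

/-- A cocycle on a path connected space which is trivial on the loops at one point is trivial on
all loops. -/
theorem eq_one_of_loops [PathConnectedSpace X] (c : PathCocycle X H) (o : X)
    (h : ∀ p : Path o o, c p = 1) {x : X} (p : Path x x) : c p = 1 := by
  obtain ⟨g, -, hg⟩ := exists_gauge (trivial X H) c o (fun p => (h p).symm)
  rw [hg, gauge_apply, trivial_apply]
  group

end PathCocycle

namespace CollaredPushout

variable {X A B T H : Type*} [TopologicalSpace X] [TopologicalSpace A]
    [TopologicalSpace B] [TopologicalSpace T] [Group H] (D : CollaredPushout X A B T)

theorem τB_injective : Function.Injective D.τB := by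
  intro t t' h
  rw [← D.collar_zero, ← D.collar_zero] at h
  exact congrArg Prod.fst (D.isOpenEmbedding_collar.injective h)

/-- **Existence part of the Seifert–van Kampen theorem** for a decomposition into closed pieces. -/
theorem exists_glue_of_loops [PathConnectedSpace T] (cA : PathCocycle A H) (cB : PathCocycle B H)
    (o : T) (h : ∀ p : Path o o, cA.comap D.τA p = cB.comap D.τB p) :
    ∃ c : PathCocycle X H, c.comap D.iA = cA := by
  -- Agreement on loops is agreement on `T` up to gauge. The gauge is extended by 1 to `B` and
  -- absorbed into `cB`, so that `cA` itself is preserved.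
  obtain ⟨g, -, hg⟩ := PathCocycle.exists_gauge (cB.comap D.τB) (cA.comap D.τA) o
    (fun p => (h p).symm)
  obtain ⟨c, hc, -⟩ := D.exists_glue cA (cB.gauge (Function.extend D.τB g 1)) (by
    rw [hg, PathCocycle.comap_gauge, Function.extend_comp D.τB_injective])
  exact ⟨c, hc⟩

/-- **Uniqueness part of the Seifert–van Kampen theorem** for a decomposition into closed
pieces. -/
theorem eq_on_loops [PathConnectedSpace T] [PathConnectedSpace B] (c c' : PathCocycle X H)
    (hA : c.comap D.iA = c'.comap D.iA) (o : T)
    (hB : ∀ p : Path (D.τB o) (D.τB o), c.comap D.iB p = c'.comap D.iB p) {a : A}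
    (p : Path (D.iA a) (D.iA a)) : c p = c' p := by
  classical
  obtain ⟨g, hg1, hg⟩ := PathCocycle.exists_gauge (c.comap D.iB) (c'.comap D.iB) _ hB
  -- On `T` the two cocycles already coincide, being restricted from `A`, so the gauge is constant
  -- there with its value 1 at `o`. It therefore extends by 1 over `A`.
  have hT : ∀ t, g (D.τB t) = 1 := by
    intro t
    let γ : Path o t := PathConnectedSpace.somePath o t
    have h1 : c'.comap D.iB (γ.map D.τB.continuous) = g (D.τB t) *
        c.comap D.iB (γ.map D.τB.continuous) * (g (D.τB o))⁻¹ := by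
      rw [hg, PathCocycle.gauge_apply]
    have h2 : ∀ d : PathCocycle X H, d.comap D.iB (γ.map D.τB.continuous) =
        d.comap D.iA (γ.map D.τA.continuous) := fun d => d.congr_path fun s => (D.comm _).symm
    rw [hg1, inv_one, mul_one, h2, h2, hA] at h1
    exact right_eq_mul.mp h1
  let G : X → H := Function.extend D.iB g 1
  have hGA : ∀ a, G (D.iA a) = 1 := by
    intro a
    by_cases h : ∃ b, D.iB b = D.iA a
    · obtain ⟨b, hb⟩ := h
      obtain ⟨t, -, rfl⟩ := D.glue a b hb.symm
      rw [← hb]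
      exact (D.isClosedEmbedding_iB.injective.extend_apply g 1 _).trans (hT t)
    · exact Function.extend_apply' _ _ _ h
  have h : c.gauge G = c' := by
    refine D.ext_cocycle _ _ ?_ ?_
    · rw [← hA]
      ext x y q
      change G _ * _ * (G _)⁻¹ = _
      rw [hGA, hGA, one_mul, inv_one, mul_one]
      rfl
    · rw [hg, PathCocycle.comap_gauge, Function.extend_comp D.isClosedEmbedding_iB.injective]
  rw [← h, PathCocycle.gauge_apply, hGA, one_mul, inv_one, mul_one]

/-- If `B` is the collar, then a cocycle on `A` extends to `X`. -/
theorem exists_extension_of_collar {X A T : Type*} [TopologicalSpace X] [TopologicalSpace A]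
    [TopologicalSpace T] (D : CollaredPushout X A (T × NNReal) T) (hD : ∀ t, D.τB t = (t, 0))
    (cA : PathCocycle A H) : ∃ c : PathCocycle X H, c.comap D.iA = cA := by
  obtain ⟨c, hc, -⟩ := D.exists_glue cA ((cA.comap D.τA).comap ContinuousMap.fst) (by
    ext x y p
    refine cA.congr_path fun t => ?_
    change D.τA _ = D.τA (D.τB _).1
    rw [hD])
  exact ⟨c, hc⟩

/-- If `B` is the collar, then cocycles on `X` are determined on loops by their restriction
to `A`. -/
theorem eq_on_loops_of_collar {X A T : Type*} [TopologicalSpace X] [TopologicalSpace A]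
    [TopologicalSpace T] [PathConnectedSpace T] (D : CollaredPushout X A (T × NNReal) T)
    (hD : ∀ t, D.τB t = (t, 0)) (c c' : PathCocycle X H)
    (hA : c.comap D.iA = c'.comap D.iA) {a : A} (p : Path (D.iA a) (D.iA a)) : c p = c' p := by
  have : PathConnectedSpace NNReal := by
    have h : Function.Surjective Real.toNNReal := fun x => ⟨x, Real.toNNReal_coe⟩
    exact h.pathConnectedSpace continuous_real_toNNReal
  obtain ⟨o⟩ : Nonempty T := inferInstance
  refine D.eq_on_loops c c' hA o ?_ p
  intro q
  -- A loop based at level zero of the collar can be pushed down to `T`, hence into `A`.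
  have key : ∀ d : PathCocycle X H, d.comap D.iB q = d.comap D.iA
      ((q.map continuous_fst).map D.τA.continuous) := by
    intro d
    rw [map_collar]
    have h1 : (d.comap D.iB) (track (D.τB o)) = 1 := by
      refine (d.comap D.iB).map_const _ fun s => ?_
      change ((D.τB o).1, (D.τB o).2 * _) = ((D.τB o).1, 0)
      rw [hD, zero_mul]
    rw [h1, one_mul, inv_one, mul_one]
    refine d.congr_path fun s => ?_
    change D.iB _ = D.iA (D.τA _)
    rw [D.comm]
    exact congrArg D.iB (hD _).symm
  rw [key, key, hA]

end CollaredPushout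

/-! ### The complement of the satellite as a union of two exteriors -/

namespace KnotTheory.Satellite

variable {K α J : Knot} (S : Satellite K α J)

/-- The inclusion of `E_J` into `E_α ∪ E_J ≅ S³`. -/
def inclJ (q : exterior S.tubeJ) : S3 := S.homeo (Quot.mk _ (Sum.inr q))

theorem continuous_inclJ : Continuous S.inclJ :=
  S.homeo.continuous.comp (continuous_quot_mk.comp continuous_inr)

/-- The quotient is by the equivalence relation generated by the gluing. To recover the gluing
itself, each point of $E_J$ is sent to its set of partners and each point of $E_\alpha$ to its
singleton; injectivity of the tubes makes this constant on classes. -/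
theorem glueRel_of_incl_eq {p : exterior S.tubeα} {q : exterior S.tubeJ}
    (h : S.incl p = S.inclJ q) : GlueRel S.tubeα S.tubeJ (Sum.inl p) (Sum.inr q) := by
  have h := S.homeo.injective h
  let F : exterior S.tubeα ⊕ exterior S.tubeJ → Set (exterior S.tubeα) :=
    Sum.elim (fun p => {p}) (fun b => {p | GlueRel S.tubeα S.tubeJ (Sum.inl p) (Sum.inr b)})
  have hF : ∀ a b, GlueRel S.tubeα S.tubeJ a b → F a = F b := by
    rintro (a | a) (b | b) hab
    · exact hab.elim
    · ext c
      simp only [F, Sum.elim_inl, Sum.elim_inr, Set.mem_singleton_iff, Set.mem_ofPred_eq]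
      constructor
      · rintro rfl; exact hab
      · rintro ⟨z, w, h1, h2⟩
        obtain ⟨z', w', h1', h2'⟩ := hab
        have h3 := S.isTubeJ.isOpenEmbedding.injective (h2.symm.trans h2')
        have h4 : w = w' := congrArg Prod.fst h3
        have h5 : (z : ℂ) = z' := congrArg Prod.snd h3
        apply Subtype.ext
        rw [h1, h1', h4, Circle.ext h5]
    · exact hab.elim
    · exact hab.elim
  have h' : F (Sum.inl p) = F (Sum.inr q) := congrArg (Quot.lift F hF) h
  have h'' : p ∈ F (Sum.inl p) := rfl
  rwa [h'] at h''

theorem inclJ_injective : Function.Injective S.inclJ := by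
  intro p q hpq
  have h := S.homeo.injective hpq
  let F : exterior S.tubeα ⊕ exterior S.tubeJ → Set (exterior S.tubeJ) :=
    Sum.elim (fun a => {q | GlueRel S.tubeα S.tubeJ (Sum.inl a) (Sum.inr q)}) (fun q => {q})
  have hF : ∀ a b, GlueRel S.tubeα S.tubeJ a b → F a = F b := by
    rintro (a | a) (b | b) hab
    · exact hab.elim
    · ext c
      simp only [F, Sum.elim_inl, Sum.elim_inr, Set.mem_singleton_iff, Set.mem_ofPred_eq]
      constructor
      · rintro ⟨z, w, h1, h2⟩
        obtain ⟨z', w', h1', h2'⟩ := hab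
        have h3 := S.isTubeα.isOpenEmbedding.injective (h1.symm.trans h1')
        have h4 : z = z' := congrArg Prod.fst h3
        have h5 : (w : ℂ) = w' := congrArg Prod.snd h3
        apply Subtype.ext
        rw [h2, h2', h4, Circle.ext h5]
      · rintro rfl; exact hab
    · exact hab.elim
    · exact hab.elim
  have h' : F (Sum.inr p) = F (Sum.inr q) := congrArg (Quot.lift F hF) h
  exact Set.singleton_injective h'

theorem inclJ_notMem (q : exterior S.tubeJ) : S.inclJ q ∉ S.knot.carrier := by
  rintro ⟨z, hz⟩
  obtain ⟨z', w', h, -⟩ := S.glueRel_of_incl_eq hz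
  exact S.notMem_closedTube z ⟨(z', (w' : ℂ)), (Circle.norm_coe w').le, h.symm⟩

theorem torusα_mem (z w : Circle) :
    S.tubeα (z, (w : ℂ)) ∈ exterior S.tubeα ∧ S.tubeα (z, (w : ℂ)) ∉ K.carrier := by
  refine ⟨(mem_exterior_tube_iff S.isTubeα.isOpenEmbedding _).mpr (Circle.norm_coe w).ge, ?_⟩
  exact fun h => Set.disjoint_left.mp S.disjoint h ⟨_, (Circle.norm_coe w).le, rfl⟩

theorem polarOut_mem (v : (Circle × Circle) × NNReal) :
    S.tubeJ (polarOut v) ∈ exterior S.tubeJ := by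
  have h : polarOut v ∈ Set.range polarOut := ⟨v, rfl⟩
  rw [range_polarOut] at h
  exact (mem_exterior_tube_iff S.isTubeJ.isOpenEmbedding _).mpr h

theorem isClosedEmbedding_incl : IsClosedEmbedding S.incl := by
  have : CompactSpace (exterior S.tubeα) := isCompact_iff_compactSpace.mp
    (isClosed_exterior S.isTubeα.isOpenEmbedding).isCompact
  exact S.continuous_incl.isClosedEmbedding S.incl_injective

/-- The complement of the satellite knot is the union of the exteriors of `K ∪ α` and of `J`. -/
noncomputable def decomposition :
    CollaredPushout S.knot.Complement S.LinkExterior (exterior S.tubeJ) (Circle × Circle) where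
  iA := S.toSatellite
  iB := ⟨fun q => ⟨S.inclJ q, S.inclJ_notMem q⟩, S.continuous_inclJ.subtype_mk _⟩
  -- The torus carries the coordinates of the tube of `J`, so they are swapped for `α`: `torusLong`
  -- is the longitude of `J` and the meridian of `α`, and `torusMer` is the meridian of `J` and the
  -- longitude of `α`.
  τA := ⟨fun t => ⟨S.tubeα (t.2, (t.1 : ℂ)), S.torusα_mem t.2 t.1⟩,
    (S.isTubeα.isOpenEmbedding.continuous.comp (by fun_prop)).subtype_mk _⟩
  τB := ⟨fun t => ⟨S.tubeJ (t.1, (t.2 : ℂ)),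
      (mem_exterior_tube_iff S.isTubeJ.isOpenEmbedding _).mpr (Circle.norm_coe t.2).ge⟩,
    (S.isTubeJ.isOpenEmbedding.continuous.comp (by fun_prop)).subtype_mk _⟩
  collar := ⟨fun v => ⟨S.tubeJ (polarOut v), S.polarOut_mem v⟩,
    (S.isTubeJ.isOpenEmbedding.continuous.comp polarOut.continuous).subtype_mk _⟩
  isClosedEmbedding_iA := by
    have hc : Continuous fun x : S.LinkExterior => (⟨x.1, x.2.1⟩ : exterior S.tubeα) :=
      continuous_subtype_val.subtype_mk _
    refine ⟨IsEmbedding.of_comp S.toSatellite.continuous continuous_subtype_val ?_, ?_⟩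
    · refine S.isClosedEmbedding_incl.isEmbedding.comp (IsEmbedding.of_comp hc
        continuous_subtype_val ?_)
      exact IsEmbedding.subtypeVal
    · convert S.isClosedEmbedding_incl.isClosed_range.preimage (continuous_subtype_val
        (p := fun x => x ∉ S.knot.carrier)) using 1
      ext ⟨x, hx⟩
      constructor
      · rintro ⟨y, hy⟩
        exact ⟨_, congrArg Subtype.val hy⟩
      · rintro ⟨y, hy⟩
        refine ⟨⟨y.1, y.2, ?_⟩, Subtype.ext hy⟩
        rintro ⟨z, hz⟩
        refine hx ⟨z, ?_⟩
        exact (congrArg S.incl (Subtype.ext hz)).trans hy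
  isClosedEmbedding_iB := by
    have : CompactSpace (exterior S.tubeJ) := isCompact_iff_compactSpace.mp
      (isClosed_exterior S.isTubeJ.isOpenEmbedding).isCompact
    exact Continuous.isClosedEmbedding (ContinuousMap.continuous _) fun p q h =>
      S.inclJ_injective (congrArg Subtype.val h)
  cover := by
    rintro ⟨x, hx⟩
    obtain ⟨c, rfl⟩ := S.homeo.surjective x
    obtain ⟨p | q, rfl⟩ := Quot.exists_rep c
    · refine Or.inl ⟨⟨p.1, p.2, ?_⟩, rfl⟩
      rintro ⟨z, hz⟩
      exact hx ⟨z, congrArg S.incl (Subtype.ext hz)⟩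
    · exact Or.inr ⟨q, rfl⟩
  comm t := by
    apply Subtype.ext
    exact congrArg S.homeo (Quot.sound ⟨t.2, t.1, rfl, rfl⟩)
  glue := by
    intro a b h
    obtain ⟨z, w, h1, h2⟩ := S.glueRel_of_incl_eq (congrArg Subtype.val h)
    exact ⟨(w, z), Subtype.ext h1, Subtype.ext h2⟩
  isOpenEmbedding_collar := by
    refine ⟨IsEmbedding.of_comp (ContinuousMap.continuous _) continuous_subtype_val ?_, ?_⟩
    · exact S.isTubeJ.isOpenEmbedding.isEmbedding.comp isEmbedding_polarOut
    · convert S.isTubeJ.isOpenEmbedding.isOpen_range.preimage (continuous_subtype_val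
        (p := fun x => x ∈ exterior S.tubeJ)) using 1
      ext ⟨x, hx⟩
      constructor
      · rintro ⟨v, hv⟩
        exact ⟨_, congrArg Subtype.val hv⟩
      · rintro ⟨p, rfl⟩
        have h : p ∈ Set.range polarOut := by
          rw [range_polarOut]
          exact (mem_exterior_tube_iff S.isTubeJ.isOpenEmbedding p).mp hx
        obtain ⟨v, rfl⟩ := h
        exact ⟨v, rfl⟩
  collar_zero := by
    rintro ⟨z, w⟩
    apply Subtype.ext
    simp [polarOut]

end KnotTheory.Satellite

/-! ### Auxiliary facts on disks, epimorphisms and change of base point -/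

instance : SimplyConnectedSpace (Metric.closedBall (0 : ℂ) 1) := by
  have : ContractibleSpace (Metric.closedBall (0 : ℂ) 1) :=
    (convex_closedBall (0 : ℂ) 1).contractibleSpace ⟨0, by simp⟩
  infer_instance

/-- Epimorphisms of groups are surjective. This gives surjectivity from the uniqueness half of van
Kampen's theorem alone. -/
theorem surjective_of_cancel {A B : Type} [Group A] [Group B] (f : A →* B)
    (h : ∀ (H : Type) [Group H] (u v : B →* H), u.comp f = v.comp f → u = v) :
    Function.Surjective f := by
  have : CategoryTheory.Epi (GrpCat.ofHom f) := ⟨fun u v huv => by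
    apply GrpCat.hom_ext
    exact h _ u.hom v.hom (congrArg GrpCat.Hom.hom huv)⟩
  exact (GrpCat.epi_iff_surjective (GrpCat.ofHom f)).mp this

theorem KnotTheory.HasAlexanderPolynomial.congr {G G' : Type*} [Group G] [Group G']
    {Δ : LaurentPolynomial ℤ} (h : HasAlexanderPolynomial G Δ) (φ : G ≃* G') :
    HasAlexanderPolynomial G' Δ := by
  obtain ⟨k, r, e, a, j, hker, ha, hdet⟩ := h
  refine ⟨k, r, e.trans φ, a.comp φ.symm.toMonoidHom, j, ?_, ?_, hdet⟩
  · have h1 : (commutator G).map φ.toMonoidHom = commutator G' := by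
      rw [commutator_def, commutator_def, Subgroup.map_commutator,
        Subgroup.map_top_of_surjective _ φ.surjective]
    rw [← h1, ← hker, ← MonoidHom.comap_ker]
    exact (Subgroup.map_equiv_eq_comap_symm φ a.ker).symm
  · intro l
    change a (φ.symm (φ (e _))) = _
    rw [φ.symm_apply_apply]
    exact ha l

/-! ### Meridians, longitudes and homomorphisms of a knot group -/

namespace KnotTheory.IsTube

open PathCocycle

variable {K : Knot} {ν : Circle × ℂ → S3} (h : IsTube K.curve ν) {H : Type*} [Group H]

/-- The knot complement as the union of the exterior of a tube and the punctured tube. -/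
noncomputable def puncture : CollaredPushout K.Complement (exterior ν)
    ((Circle × Circle) × NNReal) (Circle × Circle) :=
  punctureDecomposition h.isOpenEmbedding (W := fun _ => True) (P := fun x => x ∈ exterior ν)
    (Q := fun x => x ∉ K.carrier) (fun _ _ => trivial) (fun _ => (and_iff_left trivial).symm)
    (fun x => by simp [Knot.carrier, h.core])

/-- The sphere as the union of the exterior of a tube and the tube. -/
noncomputable def fill : CollaredPushout {_x : S3 // True} (exterior ν)
    (Circle × Metric.closedBall (0 : ℂ) 1) (Circle × Circle) :=
  fillDecomposition h.isOpenEmbedding (W := fun _ => True) (P := fun x => x ∈ exterior ν)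
    (fun _ _ => trivial) (fun _ => (and_iff_left trivial).symm)

include h in
theorem pathConnectedSpace_exterior : PathConnectedSpace (exterior ν) := by
  refine _root_.pathConnectedSpace_exterior h.isOpenEmbedding (W := fun _ => True)
    (P := fun x => x ∈ exterior ν) isOpen_univ ?_ (fun _ _ => trivial)
    (fun _ => (and_iff_left trivial).symm)
  exact isPathConnected_univ_sphere

/-- A knot group is normally generated by a meridian. -/
theorem eq_one_of_meridian (c : PathCocycle K.Complement H)
    (hm : c (circleLoop h.meridian) = 1) {x : K.Complement} (p : Path x x) : c p = 1 := by
  let T : C(Circle × Circle, exterior ν) := h.fill.τA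
  let cE : PathCocycle (exterior ν) H := c.comap h.puncture.iA
  -- Filling the tube back in: the value on the longitude defines a cocycle on the solid torus
  -- through its projection to the core, and it matches on the meridian because both values are 1.
  -- The extension lives on the sphere, where loops are trivial.
  obtain ⟨c', hc'⟩ := h.fill.exists_glue_of_loops cE
    ((cE.comap T).comap ⟨fun p => (p.1, 1), by fun_prop⟩) (1, 1) (by
      refine torus_ext _ _ ?_ ?_
      · exact cE.congr_path fun t => rfl
      · trans 1
        · exact (c.congr_path fun t => rfl).trans hm
        · exact ((cE.comap T).map_const _ fun t => rfl).symm)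
  let c'' : PathCocycle K.Complement H :=
    c'.comap ⟨fun x => ⟨x.1, trivial⟩, continuous_subtype_val.subtype_mk _⟩
  have hA : c''.comap h.puncture.iA = c.comap h.puncture.iA := by
    refine Eq.trans ?_ hc'
    ext a b p
    exact c'.congr_path fun t => rfl
  refine c.eq_one_of_loops (h.puncture.iA (T (1, 1))) (fun p => ?_) p
  rw [← h.puncture.eq_on_loops_of_collar (fun _ => rfl) c'' c hA p]
  exact sphere_trivial (c'.comap ⟨fun x => ⟨x, trivial⟩, continuous_id.subtype_mk _⟩)
    (p.map continuous_subtype_val)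

/-- The class of the meridian. -/
noncomputable def meridianClass : K.Group (h.meridian 1) :=
  FundamentalGroup.fromPath (Path.Homotopic.Quotient.mk (circleLoop h.meridian))

theorem eq_one_of_meridianClass (φ : K.Group (h.meridian 1) →* H)
    (hφ : φ h.meridianClass = 1) : φ = 1 := by
  obtain ⟨c, hc⟩ := exists_extension _ φ
  ext g
  induction g using Path.Homotopic.Quotient.ind with | _ p
  exact (hc p).symm.trans (h.eq_one_of_meridian c ((hc _).trans hφ) p)

/-- There is an abelianization of the knot group in which the meridian generates. -/
theorem exists_abelianization {Δ : LaurentPolynomial ℤ}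
    (hK : HasAlexanderPolynomial (K.Group (h.meridian 1)) Δ) :
    ∃ a : K.Group (h.meridian 1) →* Multiplicative ℤ, a.ker = commutator _ ∧
      ∃ ε : ℤ, a h.meridianClass ^ ε = Multiplicative.ofAdd 1 := by
  obtain ⟨k, r, e, a, j, hker, ha, -⟩ := hK
  refine ⟨a, hker, ?_⟩
  -- Modulo the subgroup generated by the image of the meridian, the abelianization kills the
  -- meridian and hence everything; so the generator of $\mathbb Z$ lies in that subgroup.
  have h1 := h.eq_one_of_meridianClass
    ((QuotientGroup.mk' (Subgroup.zpowers (a h.meridianClass))).comp a)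
    ((QuotientGroup.eq_one_iff _).mpr (Subgroup.mem_zpowers _))
  have h2 := DFunLike.congr_fun h1 (e (PresentedGroup.of j))
  have h3 := (QuotientGroup.eq_one_iff _).mp h2
  rw [ha] at h3
  exact h3

/-- For knots with Alexander polynomial one, homomorphisms to a residually solvable group kill the
commutator subgroup. -/
theorem map_commutator_eq_one {G : Type*} [Group G] (hH : IsResiduallySolvable H)
    (hG : HasAlexanderPolynomial G 1) (φ : G →* H) {g : G} (hg : g ∈ commutator G) : φ g = 1 :=
  IsResiduallySolvable.map_eq_one hH (commutator_perfect_of_hasAlexanderPolynomial hG) φ hg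

/-- For knots with Alexander polynomial one, homomorphisms to a residually solvable group are
determined by the meridian. -/
theorem eq_on_loops_of_meridian (hK : HasAlexanderPolynomial (K.Group (h.meridian 1)) 1)
    (hH : IsResiduallySolvable H) (c c' : PathCocycle K.Complement H)
    (hm : c (circleLoop h.meridian) = c' (circleLoop h.meridian))
    (p : Path (h.meridian 1) (h.meridian 1)) : c p = c' p := by
  obtain ⟨a, hker, ε, hε⟩ := h.exists_abelianization hK
  let g : K.Group (h.meridian 1) := FundamentalGroup.fromPath (Path.Homotopic.Quotient.mk p)
  -- Modulo commutators every class is a power of the meridian, with an exponent read from the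
  -- abelianization.
  have hg : g * (h.meridianClass ^ (ε * (a g).toAdd))⁻¹ ∈ commutator (K.Group (h.meridian 1)) := by
    rw [← hker, MonoidHom.mem_ker, map_mul, map_inv, map_zpow, zpow_mul, hε, ← ofAdd_zsmul]
    simp
  have key : ∀ d : PathCocycle K.Complement H,
      d p = d (circleLoop h.meridian) ^ (ε * (a g).toAdd) := by
    intro d
    have h1 := map_commutator_eq_one hH hK (d.toHom _) hg
    rw [map_mul, map_inv, map_zpow, mul_inv_eq_one] at h1
    exact h1
  rw [key, key, hm]

/-- The version of `eq_on_loops_of_meridian` for the exterior of the tube. -/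
theorem eq_on_loops_exterior (hK : HasAlexanderPolynomial (K.Group (h.meridian 1)) 1)
    (hH : IsResiduallySolvable H) (c c' : PathCocycle (exterior ν) H)
    (hm : c.comap h.puncture.τA (circleLoop torusMer) =
      c'.comap h.puncture.τA (circleLoop torusMer))
    (p : Path (h.puncture.τA (1, 1)) (h.puncture.τA (1, 1))) : c p = c' p := by
  obtain ⟨d, rfl⟩ := h.puncture.exists_extension_of_collar (fun _ => rfl) c
  obtain ⟨d', rfl⟩ := h.puncture.exists_extension_of_collar (fun _ => rfl) c'
  have hl : ∀ d : PathCocycle K.Complement H, (d.comap h.puncture.iA).comap h.puncture.τA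
      (circleLoop torusMer) = d (circleLoop h.meridian) := fun d => d.congr_path fun t => rfl
  rw [hl, hl] at hm
  exact h.eq_on_loops_of_meridian hK hH d d' hm (p.map h.puncture.iA.continuous)

/-- Zero linking places the longitude in the commutator subgroup, which every homomorphism to a
residually solvable group kills. -/
theorem longitude_eq_one (hK : HasAlexanderPolynomial (K.Group (h.meridian 1)) 1)
    (h0 : h.ZeroLinking) (hH : IsResiduallySolvable H) (c : PathCocycle (exterior ν) H) :
    c.comap h.puncture.τA (circleLoop torusLong) = 1 := by
  obtain ⟨d, rfl⟩ := h.puncture.exists_extension_of_collar (fun _ => rfl) c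
  trans d (circleLoop h.longitude)
  · exact d.congr_path fun t => rfl
  · exact map_commutator_eq_one hH hK (d.toHom _) h0

/-- Every element of a group is the image of the meridian under a homomorphism from the knot
group which kills the longitude. -/
theorem exists_cocycle_exterior {Δ : LaurentPolynomial ℤ}
    (hK : HasAlexanderPolynomial (K.Group (h.meridian 1)) Δ) (h0 : h.ZeroLinking) (g : H) :
    ∃ c : PathCocycle (exterior ν) H, c.comap h.puncture.τA (circleLoop torusMer) = g ∧
      c.comap h.puncture.τA (circleLoop torusLong) = 1 := by
  obtain ⟨a, hker, ε, hε⟩ := h.exists_abelianization hK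
  -- The meridian maps to an integer whose product with `ε` is 1, so sending the generator to `g ^
  -- ε` sends the meridian to `g`, whichever sign the meridian has.
  let φ : Multiplicative ℤ →* H := zpowersHom H (g ^ ε)
  obtain ⟨d, hd⟩ := exists_extension _ (φ.comp a)
  refine ⟨d.comap h.puncture.iA, ?_, ?_⟩
  · refine (d.congr_path fun t => rfl).trans ((hd (circleLoop h.meridian)).trans ?_)
    change (g ^ ε) ^ (a h.meridianClass).toAdd = g
    have h1 : (a h.meridianClass).toAdd * ε = 1 := by
      have := congrArg Multiplicative.toAdd hε
      rw [toAdd_zpow, toAdd_ofAdd, smul_eq_mul, mul_comm] at this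
      exact this
    rw [← zpow_mul, mul_comm, h1, zpow_one]
  · refine (d.congr_path fun t => rfl).trans ((hd (circleLoop h.longitude)).trans ?_)
    have h1 : FundamentalGroup.fromPath (Path.Homotopic.Quotient.mk (circleLoop h.longitude)) ∈
      a.ker := by rw [hker]; exact h0
    exact (congrArg φ (MonoidHom.mem_ker.mp h1)).trans (map_one φ)

end KnotTheory.IsTube

/-- The radial formula shows that the shrunken tube carries the unit circle to a concentric circle,
so its meridian is a rescaling of the original one. -/
theorem univBall_zero_apply {ε : ℝ} (hε : 0 < ε) (w : ℂ) :
    OpenPartialHomeomorph.univBall (0 : ℂ) ε w = ε • ((√(1 + ‖w‖ ^ 2))⁻¹ • w) := by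
  rw [OpenPartialHomeomorph.univBall, dif_pos hε]
  change (ε • ((√(1 + ‖w‖ ^ 2))⁻¹ • w) : ℂ) +ᵥ (0 : ℂ) = _
  rw [vadd_eq_add, add_zero]

theorem PathCocycle.circleLoop_congr {X H : Type*} [TopologicalSpace X] [Group H]
    (c : PathCocycle X H) {k l : C(Circle, X)} (h : ∀ w, k w = l w) :
    c (circleLoop k) = c (circleLoop l) :=
  c.congr_path fun _ => h _

/-- Conjugates of meridians are meridians. -/
theorem KnotTheory.Knot.IsMeridian.conj {K : Knot} {x : K.Complement} {g : K.Group x}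
    (hg : K.IsMeridian g) (u : K.Group x) : K.IsMeridian (u * g * u⁻¹) := by
  obtain ⟨ν, h, p, rfl⟩ := hg
  induction u using Path.Homotopic.Quotient.ind with | _ r
  -- The inverse of `r` comes first because products of loops are traversed from right to left.
  refine ⟨ν, h, r.symm.trans p, ?_⟩
  rw [FundamentalGroup.mul_def, FundamentalGroup.mul_def, FundamentalGroup.inv_def]
  simp only [Path.trans_symm, Path.symm_symm, Path.Homotopic.Quotient.mk_trans,
    Path.Homotopic.Quotient.mk_symm, FundamentalGroup.fromPath,
    Path.Homotopic.Quotient.trans_assoc]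

/-! ### The quotient map and the factorization for satellite groups -/

namespace KnotTheory.Satellite

open PathCocycle

variable {K α J : Knot} (S : Satellite K α J) {H : Type*} [Group H]

theorem tubeα_notMem (p : Circle × ℂ) (hp : ‖p.2‖ ≤ 1) : S.tubeα p ∉ K.carrier :=
  fun h => Set.disjoint_left.mp S.disjoint h ⟨p, hp, rfl⟩

instance : PathConnectedSpace S.LinkExterior :=
  pathConnectedSpace_exterior S.isTubeα.isOpenEmbedding (W := fun x => x ∉ K.carrier)
    K.isClosed_carrier.isOpen_compl K.isPathConnected_compl S.tubeα_notMem (fun _ => Iff.rfl)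

/-- The complement of `K` as the union of the exterior of `K ∪ α` and the tube about `α`. -/
noncomputable def fill : CollaredPushout K.Complement S.LinkExterior
    (Circle × Metric.closedBall (0 : ℂ) 1) (Circle × Circle) :=
  fillDecomposition S.isTubeα.isOpenEmbedding (W := fun x => x ∉ K.carrier) S.tubeα_notMem
    (fun _ => Iff.rfl)

theorem toComplement_injective : Function.Injective S.toComplement :=
  S.fill.isClosedEmbedding_iA.injective

/-- A cocycle on the exterior of `K ∪ α` which is trivial on the meridian of `α` extends over the
complement of `K`. -/
theorem exists_extension_complement (c : PathCocycle S.LinkExterior H)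
    (hc : c.comap S.decomposition.τA (circleLoop torusLong) = 1) :
    ∃ c' : PathCocycle K.Complement H, c'.comap S.toComplement = c := by
  refine S.fill.exists_glue_of_loops c
    ((c.comap S.fill.τA).comap ⟨fun p => (p.1, 1), by fun_prop⟩) (1, 1) ?_
  refine torus_ext _ _ ?_ ?_
  · exact c.congr_path fun t => rfl
  · trans 1
    · exact (c.congr_path fun t => rfl).trans hc
    · exact ((c.comap S.fill.τA).map_const _ fun t => rfl).symm

/-- In the complement of `K` the meridian of `α` bounds a disk of the tube. -/
theorem meridian_eq_one (c : PathCocycle K.Complement H) :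
    (c.comap S.toComplement).comap S.decomposition.τA (circleLoop torusLong) = 1 := by
  let i : C(Circle, Metric.closedBall (0 : ℂ) 1) :=
    ⟨fun w => ⟨w, by simp [Circle.norm_coe]⟩, by fun_prop⟩
  let d : PathCocycle (Metric.closedBall (0 : ℂ) 1) H :=
    c.comap (S.fill.iB.comp ⟨fun w => (1, w), by fun_prop⟩)
  trans d (circleLoop i)
  · exact c.congr_path fun t => rfl
  · rw [d.eq_of_simplyConnected (circleLoop i) (Path.refl _), d.map_refl]

/-- The complement of `K` has no more loops than the exterior of `K ∪ α`. -/
theorem eq_on_loops_complement (c c' : PathCocycle K.Complement H)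
    (h : c.comap S.toComplement = c'.comap S.toComplement) {x : S.LinkExterior}
    (p : Path (S.toComplement x) (S.toComplement x)) : c p = c' p := by
  refine S.fill.eq_on_loops c c' h (1, 1) (fun q => ?_) p
  -- Loops in the solid torus are powers of the longitude of `α`, which lies on the boundary torus
  -- and so in $E_{K\cup\alpha}$.
  refine prod_simplyConnected_ext _ _ _ ?_ q
  have key : ∀ d : PathCocycle K.Complement H, d.comap S.fill.iB (circleLoop
      ⟨fun z => (z, (S.fill.τB (1, 1)).2), by fun_prop⟩) =
      (d.comap S.toComplement).comap S.fill.τA (circleLoop torusLong) :=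
    fun d => d.congr_path fun t => rfl
  exact (key c).trans ((congrArg (fun e : PathCocycle S.LinkExterior H =>
    e.comap S.fill.τA (circleLoop torusLong)) h).trans (key c').symm)

theorem iStar_surjective (x : S.LinkExterior) : Function.Surjective (S.iStar x) := by
  refine surjective_of_cancel _ fun H _ u v huv => ?_
  obtain ⟨c, hc⟩ := exists_extension _ u
  obtain ⟨c', hc'⟩ := exists_extension _ v
  obtain ⟨g, hg1, hg⟩ := exists_gauge_comap_eq c c' S.toComplement S.toComplement_injective x
    fun p => (hc _).trans ((DFunLike.congr_fun huv
      (FundamentalGroup.fromPath (Path.Homotopic.Quotient.mk p))).trans (hc' _).symm)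
  ext k
  induction k using Path.Homotopic.Quotient.ind with | _ p
  have h1 := S.eq_on_loops_complement (c.gauge g) c' hg p
  rw [gauge_apply, hg1, one_mul, inv_one, mul_one] at h1
  exact (hc p).symm.trans (h1.trans (hc' p))

/-- The satellite knot has a tube which comes from a tube of `K` and lies in a given one. -/
theorem exists_tube {ν : Circle × ℂ → S3} (hν : IsTube S.knot.curve ν) :
    ∃ (μ : Circle × ℂ → {x : S3 // x ∉ closedTube S.tubeα}) (s : ℝ), 0 < s ∧
      IsTube K.curve (fun p => (μ p).1) ∧
      ∀ w : Circle, S.incl ⟨(μ (1, (w : ℂ))).1, mem_exterior_of_notMem (μ (1, (w : ℂ))).2⟩ =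
        ν (1, (s : ℂ) * (w : ℂ)) := by
  have hV := S.isOpenEmbedding_incl.isOpen_range
  obtain ⟨u, v, -, hv, hu', hv', huv⟩ := generalized_tube_lemma (s := (Set.univ : Set Circle))
    isCompact_univ (isCompact_singleton (x := (0 : ℂ)))
    (hV.preimage hν.isOpenEmbedding.continuous) (by
      rintro ⟨z, w⟩ ⟨-, hw⟩
      obtain rfl : w = 0 := hw
      rw [Set.mem_preimage, hν.core]
      exact ⟨⟨K.curve z, S.notMem_closedTube z⟩, rfl⟩)
  obtain ⟨ε, hε, hball⟩ := Metric.isOpen_iff.mp hv 0 (hv' rfl)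
  let b := OpenPartialHomeomorph.univBall (E := ℂ) (0 : ℂ) ε
  have hb : IsOpenEmbedding b :=
    b.isOpenEmbedding (OpenPartialHomeomorph.univBall_source _ _)
  have hmem : ∀ w, b w ∈ v := fun w => hball <| by
    have := b.map_source (x := w) (by
      rw [OpenPartialHomeomorph.univBall_source]; trivial)
    rwa [OpenPartialHomeomorph.univBall_target _ hε] at this
  have h1 : IsOpenEmbedding fun p : Circle × ℂ => ν (p.1, b p.2) :=
    hν.isOpenEmbedding.comp (IsOpenEmbedding.id.prodMap hb)
  have h2 : ∀ p : Circle × ℂ, ∃ x : {x : S3 // x ∉ closedTube S.tubeα},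
      S.incl ⟨x.1, mem_exterior_of_notMem x.2⟩ = ν (p.1, b p.2) := fun p =>
    huv (show (p.1, b p.2) ∈ u ×ˢ v from ⟨hu' trivial, hmem p.2⟩)
  choose μ hμ using h2
  have hμo : IsOpenEmbedding μ := by
    refine IsOpenEmbedding.of_comp μ S.isOpenEmbedding_incl ?_
    convert h1 using 1
    exact funext hμ
  -- The radial map takes norm 1 to $\varepsilon/\sqrt{1+1}$.
  refine ⟨μ, ε * (√2)⁻¹, by positivity, ⟨?_, ?_⟩, ?_⟩
  · exact (isClosed_closedTube S.isTubeα).isOpen_compl.isOpenEmbedding_subtypeVal.comp hμo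
  · intro z
    have h0 : b 0 = 0 := OpenPartialHomeomorph.univBall_apply_zero _ _
    have h3 := hμ (z, 0)
    rw [h0, hν.core] at h3
    exact congrArg (fun p : exterior S.tubeα => p.1) (S.incl_injective h3)
  · intro w
    rw [hμ]
    have h4 : b w = ((ε * (√2)⁻¹ : ℝ) : ℂ) * w := by
      refine (univBall_zero_apply hε w).trans ?_
      rw [Circle.norm_coe, smul_smul, one_pow, one_add_one_eq_two, Complex.real_smul]
    rw [h4]

/-- Homomorphisms which are compatible with the inclusions map meridians of the satellite knot to
meridians of `K`. -/
theorem isMeridian_map {x : S.LinkExterior}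
    {q : S.knot.Group (S.toSatellite x) →* K.Group (S.toComplement x)}
    (hq : q.comp (S.jStar x) = S.iStar x) {m : S.knot.Group (S.toSatellite x)}
    (hm : S.knot.IsMeridian m) : K.IsMeridian (q m) := by
  obtain ⟨ν, hν, p, rfl⟩ := hm
  obtain ⟨μ, s, hs, hμ, hμν⟩ := S.exists_tube hν
  obtain ⟨c, hc⟩ := exists_extension _ q
  -- The radius is interpolated from `s` to 1. Staying positive, it gives a free homotopy from the
  -- small meridian to the given one that avoids the knot.
  have hpos : ∀ t : I, 0 < (t : ℝ) + (1 - t) * s := fun t => by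
    rcases eq_or_lt_of_le t.2.1 with h | h
    · rw [← h]; simpa using hs
    · have := mul_nonneg (sub_nonneg.mpr t.2.2) hs.le
      linarith
  have hk : ∀ v : Circle × I,
      ν (1, (((v.2 : ℝ) + (1 - v.2) * s : ℝ) : ℂ) * (v.1 : ℂ)) ∉ S.knot.carrier := by
    rintro v ⟨z, hz⟩
    rw [← hν.core] at hz
    exact mul_ne_zero (Complex.ofReal_ne_zero.mpr (hpos v.2).ne') (Circle.coe_ne_zero _)
      (congrArg Prod.snd (hν.isOpenEmbedding.injective hz)).symm
  let k : C(Circle × I, S.knot.Complement) :=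
    ⟨fun v => ⟨_, hk v⟩, (hν.isOpenEmbedding.continuous.comp (by fun_prop)).subtype_mk hk⟩
  let l : C(Circle, S.LinkExterior) :=
    ⟨fun w => ⟨(μ (1, (w : ℂ))).1, mem_exterior_of_notMem (μ (1, (w : ℂ))).2, hμ.notMem 1 w⟩,
      (hμ.isOpenEmbedding.continuous.comp (by fun_prop)).subtype_mk _⟩
  obtain ⟨u, hu⟩ := c.circleLoop_homotopy k
  have hk1 : c (circleLoop ⟨fun z => k (z, 1), by fun_prop⟩) = c (circleLoop hν.meridian) := by
    have h : ∀ w : Circle, k (w, 1) = hν.meridian w := fun w => Subtype.ext (by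
      change ν (1, ((((1 : I) : ℝ) + (1 - ((1 : I) : ℝ)) * s : ℝ) : ℂ) * (w : ℂ)) = ν (1, (w : ℂ))
      simp)
    exact c.circleLoop_congr h
  have hk0 : c (circleLoop ⟨fun z => k (z, 0), by fun_prop⟩) =
      c.comap S.toSatellite (circleLoop l) := by
    have h : ∀ w : Circle, k (w, 0) = S.toSatellite (l w) := fun w => Subtype.ext (by
      refine Eq.trans ?_ (hμν w).symm
      change ν (1, ((((0 : I) : ℝ) + (1 - ((0 : I) : ℝ)) * s : ℝ) : ℂ) * (w : ℂ)) =
        ν (1, (s : ℂ) * (w : ℂ))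
      simp)
    exact c.circleLoop_congr (l := S.toSatellite.comp l) h
  let γ : Path x (l 1) := PathConnectedSpace.somePath x (l 1)
  let e : FundamentalGroup S.LinkExterior x := FundamentalGroup.fromPath
    (Path.Homotopic.Quotient.mk ((γ.trans (circleLoop l)).trans γ.symm))
  have he : K.IsMeridian (S.iStar x e) := by
    refine ⟨fun p => (μ p).1, hμ, γ.map S.toComplement.continuous, ?_⟩
    change FundamentalGroup.fromPath (Path.Homotopic.Quotient.mk
      (((γ.trans (circleLoop l)).trans γ.symm).map S.toComplement.continuous)) = _
    rw [Path.map_trans, Path.map_trans]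
    rfl
  have h1 : S.iStar x e = c.comap S.toSatellite ((γ.trans (circleLoop l)).trans γ.symm) := by
    rw [← hq]
    exact (hc _).symm
  rw [map_trans, map_trans, map_symm] at h1
  -- The conjugator collects the given path to the meridian, the track of the free homotopy, and the
  -- path `γ` to the small meridian.
  have h2 := he.conj ((c p)⁻¹ * u * c.comap S.toSatellite γ)
  convert h2 using 1
  rw [← hc, map_trans, map_trans, map_symm, ← hk1, hu, hk0, h1]
  group

theorem exists_isMeridian {K : Knot} (x : K.Complement) : ∃ m : K.Group x, K.IsMeridian m := by
  obtain ⟨ν, h⟩ := K.tame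
  exact ⟨_, ν, h, PathConnectedSpace.somePath _ _, rfl⟩

/-- The tautological cocycle of $G(K)$ on $E_{K\cup\alpha}$ is extended over $E_J$ through the
abelianization of $G(J)$, sending the meridian of `J` to the class of the longitude of `α`. The
longitude of `J` and the meridian of `α` both become trivial, so the pieces match on the torus. -/
theorem exists_isQuotientMap (x : S.LinkExterior) {Δ : LaurentPolynomial ℤ}
    (hJ : HasAlexanderPolynomial (J.Group (S.isTubeJ.meridian 1)) Δ) :
    ∃ q, S.IsQuotientMap x q := by
  obtain ⟨cK, hcK⟩ := exists_extension (S.toComplement x) (MonoidHom.id _)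
  obtain ⟨cB, hm, hl⟩ := S.isTubeJ.exists_cocycle_exterior hJ S.zeroLinkingJ
    ((cK.comap S.toComplement).comap S.decomposition.τA (circleLoop torusMer))
  obtain ⟨c, hc⟩ := S.decomposition.exists_glue_of_loops (cK.comap S.toComplement) cB (1, 1)
    (torus_ext _ _ ((S.meridian_eq_one cK).trans hl.symm) hm.symm)
  have hcomp : (c.toHom (S.toSatellite x)).comp (S.jStar x) = S.iStar x := by
    ext g
    induction g using Path.Homotopic.Quotient.ind with | _ p
    change c.comap S.decomposition.iA p = _
    rw [hc]
    exact hcK _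
  obtain ⟨m, hm⟩ := exists_isMeridian (S.toSatellite x)
  refine ⟨_, ?_, ⟨m, hm, S.isMeridian_map hcomp hm⟩, hcomp⟩
  have h1 := S.iStar_surjective x
  rw [← hcomp] at h1
  exact Function.Surjective.of_comp h1

/-- Homomorphisms from the group of the satellite knot to a residually solvable group factor
through the group of `K`. -/
theorem exists_factorization (x : S.LinkExterior)
    (hJ : HasAlexanderPolynomial (J.Group (S.isTubeJ.meridian 1)) 1)
    (hH : IsResiduallySolvable H)
    {q : S.knot.Group (S.toSatellite x) →* K.Group (S.toComplement x)}
    (hq : q.comp (S.jStar x) = S.iStar x) (f : S.knot.Group (S.toSatellite x) →* H) :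
    ∃ f' : K.Group (S.toComplement x) →* H, f'.comp q = f := by
  obtain ⟨F, hF⟩ := exists_extension _ f
  -- The meridian of `α` is the longitude of `J`, which `f` kills.
  obtain ⟨F', hF'⟩ := S.exists_extension_complement (F.comap S.toSatellite) (by
    refine Eq.trans ?_ (S.isTubeJ.longitude_eq_one hJ S.zeroLinkingJ hH
      (F.comap S.decomposition.iB))
    exact F.congr_path fun t => S.decomposition.comm _)
  refine ⟨F'.toHom _, ?_⟩
  obtain ⟨R, hR⟩ := exists_extension _ ((F'.toHom (S.toComplement x)).comp q)
  have hRF : ∀ p : Path x x, R.comap S.toSatellite p = F.comap S.toSatellite p := by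
    intro p
    refine (hR _).trans ?_
    have h1 := DFunLike.congr_fun hq (FundamentalGroup.fromPath (Path.Homotopic.Quotient.mk p))
    refine (congrArg (F'.toHom (S.toComplement x)) h1).trans ?_
    change F'.comap S.toComplement p = _
    rw [hF']
  obtain ⟨g, hg1, hg⟩ := exists_gauge_comap_eq R F S.toSatellite
    S.decomposition.isClosedEmbedding_iA.injective x hRF
  have := S.isTubeJ.pathConnectedSpace_exterior
  have hmer : ∀ d : PathCocycle S.knot.Complement H,
      (d.comap S.decomposition.iB).comap S.decomposition.τB (circleLoop torusMer) =
      (d.comap S.toSatellite).comap S.decomposition.τA (circleLoop torusMer) := fun d =>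
    d.congr_path fun t => (S.decomposition.comm _).symm
  -- Once the two cocycles coincide on $E_{K\cup\alpha}$, they coincide on the meridian of `J` in
  -- the common torus, which determines them on the loops of $E_J$.
  have key : ∀ p : Path (S.toSatellite x) (S.toSatellite x), R.gauge g p = F p := fun p =>
    S.decomposition.eq_on_loops (R.gauge g) F hg (1, 1)
      (S.isTubeJ.eq_on_loops_exterior hJ hH _ _ (by
        refine (hmer _).trans (Eq.trans ?_ (hmer _).symm)
        rw [hg])) p
  ext k
  induction k using Path.Homotopic.Quotient.ind with | _ p
  have h1 := key p
  rw [gauge_apply, hg1, one_mul, inv_one, mul_one] at h1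
  exact (hR p).symm.trans (h1.trans (hF p))

end KnotTheory.Satellite

/-! ### The main theorem -/

theorem mainTheorem3 (K α J T : Knot) (hα : α.IsUnknotted) (S : Satellite K α J)
    (x : S.LinkExterior) (y : J.Complement) (t : T.Complement)
    (hT : IsResiduallySolvable (T.Group t)) (hJ : HasAlexanderPolynomial (J.Group y) 1) :
    (∃ q, S.IsQuotientMap x q) ∧
    ∀ q, S.IsQuotientMap x q →
      ∀ f : S.knot.Group (S.toSatellite x) →* T.Group t,
        ∃ f' : K.Group (S.toComplement x) →* T.Group t,
          f'.comp q = f ∧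
          f'.comp (S.iStar x) = f.comp (S.jStar x) ∧
          (Function.Surjective f → Function.Surjective f') ∧
          (IsMeridional f → IsMeridional f') := by
  -- The base point is moved to the tube of `J`, where the meridian and the longitude start.
  have hJ' : HasAlexanderPolynomial (J.Group (S.isTubeJ.meridian 1)) 1 :=
    hJ.congr (FundamentalGroup.fundamentalGroupMulEquivOfPathConnected _ _)
  refine ⟨S.exists_isQuotientMap x hJ', fun q hq f => ?_⟩
  obtain ⟨f', rfl⟩ := S.exists_factorization x hJ' hT hq.comp_jStar f
  refine ⟨f', rfl, ?_, fun h => ?_, ?_⟩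
  · rw [MonoidHom.comp_assoc, hq.comp_jStar]
  · exact Function.Surjective.of_comp h
  · rintro ⟨m, hm, hfm⟩
    -- `q` sends every meridian to a meridian, so the one that witnesses meridionality of `f` can be
    -- pushed forward.
    exact ⟨q m, S.isMeridian_map hq.comp_jStar hm, hfm⟩
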